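/- Let $h(t)$, $t\in\mathbb R$, be a unit-power Rayleigh fading channel, i.e. a zero-mean, circularly symmetric complex Gaussian process ($\mathbb E[h(s)h(t)]=0$ for all $s,t$) with $\mathbb E|h(t)|^2=1$ and $\mathbb E[h(t)h^\star(t-\tau)]=\rho_h(\tau)$ for all $t,\tau$. Let $T_s>0$ and, for an SNR $\eta>0$ and $l\in\mathbb Z$, let $\mathcal I_l=\log_2\left(1+\eta|h(lT_s)|^2\right)$ be the instantaneous mutual information. For $l,i\in\mathbb Z$ put $$r_{\mathcal I}(i)=\mathbb E[\mathcal I_l\mathcal I_{l-i}],\qquad \tilde r_{\mathcal I}(i)=\frac{r_{\mathcal I}(i)}{\mathbb E[\mathcal I_l^2]},\qquad \rho_{\mathcal I}(i)=\frac{r_{\mathcal I}(i)-(\mathbb E\mathcal I_l)^2}{\mathbb E[\mathcal I_l^2]-(\mathbb E\mathcal I_l)^2}.$$ Let $\gamma=e^{C}=1.781072\ldots$, where $C=0.5772\ldots$ is the Euler–Mascheroni constant, let $\mathrm{Li}_2(x)=\sum_{k\ge1}x^k/k^2$ for $|x|\le1$, and let $H_k=\sum_{j=1}^k 1/j$, $H_0=0$.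 Suppose that $i$ is such that $\varrho_i=|\rho_h(iT_s)|<1$. Then the following hold. (a) For every $\eta>0$, $\mathcal I_l$ and $\mathcal I_{l-i}$ are square integrable, $\mathbb E[\mathcal I_l^2]>0$ and $\mathbb E[\mathcal I_l^2]-(\mathbb E\mathcal I_l)^2>0$. (b) As $\eta\to\infty$, $$\frac{r_{\mathcal I}(i)}{(\log_2e)^2}=\mathrm{Li}_2(\varrho_i^2)+\ln^2\frac{\eta}{\gamma}+o(1),\qquad \frac{\mathbb E[\mathcal I_l^2]}{(\log_2e)^2}=\frac{\pi^2}{6}+\ln^2\frac{\eta}{\gamma}+o(1).$$ (c) As $\eta\to\infty$, $$\tilde r_{\mathcal I}(i)=\frac{\mathrm{Li}_2(\varrho_i^2)+\ln^2\frac{\eta}{\gamma}}{\frac{\pi^2}{6}+\ln^2\frac{\eta}{\gamma}}+o\!\left(\frac1{\ln^2(\eta/\gamma)}\right).$$ (d) $\displaystyle\lim_{\eta\to\infty}\rho_{\mathcal I}(i)=\frac{6\,\mathrm{Li}_2(\varrho_i^2)}{\pi^2}.$ (e) For every real $t$ with $|t|<1$, the series below converge and $$\sum_{k\ge0}H_kt^k=-\frac{\ln(1-t)}{1-t},\qquad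 \sum_{k\ge0}H_k^2t^k=\frac{\mathrm{Li}_2(t)+\ln^2(1-t)}{1-t}.$$ -/

import Mathlib

open MeasureTheory ProbabilityTheory Filter Topology

/-- A unit-power (flat) Rayleigh fading channel `h(t)` with correlation function `ρh`: a zero-mean,
circularly symmetric, wide-sense stationary complex Gaussian process with
`E[h(t) h*(t - τ)] = ρh(τ)` and `E[|h(t)|²] = 1`. For a zero-mean complex Gaussian process, circular
symmetry means that the pseudo-covariance `E[h(t) h(s)]` vanishes. -/
structure IsRayleighFading {Ω : Type*} [MeasurableSpace Ω] (P : Measure Ω)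
    (h : ℝ → Ω → ℂ) (ρh : ℝ → ℂ) : Prop where
  gaussian : IsGaussianProcess h P
  zero_mean : ∀ t, ∫ ω, h t ω ∂P = 0
  circular : ∀ s t, ∫ ω, h s ω * h t ω ∂P = 0
  unit_power : ∀ t, ∫ ω, ‖h t ω‖ ^ 2 ∂P = 1
  correlation : ∀ t τ, ∫ ω, h t ω * (starRingEnd ℂ) (h (t - τ) ω) ∂P = ρh τ

/-- The SISO instantaneous mutual information `I_l = log₂(1 + η |h(l Ts)|²)`. -/
noncomputable def imi {Ω : Type*} (h : ℝ → Ω → ℂ) (Ts η : ℝ) (l : ℤ) (ω : Ω) : ℝ :=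
  Real.logb 2 (1 + η * ‖h (l * Ts) ω‖ ^ 2)

/-- The autocorrelation function `r(i) = E[I_l I_{l-i}]` (at time index `l`). -/
noncomputable def imiACF {Ω : Type*} [MeasurableSpace Ω] (P : Measure Ω)
    (h : ℝ → Ω → ℂ) (Ts η : ℝ) (l i : ℤ) : ℝ :=
  ∫ ω, imi h Ts η l ω * imi h Ts η (l - i) ω ∂P

/-- The normalized autocorrelation function `r(i) / E[I_l²]`. -/
noncomputable def imiNACF {Ω : Type*} [MeasurableSpace Ω] (P : Measure Ω)
    (h : ℝ → Ω → ℂ) (Ts η : ℝ) (l i : ℤ) : ℝ :=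
  imiACF P h Ts η l i / ∫ ω, imi h Ts η l ω ^ 2 ∂P

/-- The correlation coefficient `(r(i) - E[I_l]²) / (E[I_l²] - E[I_l]²)`. -/
noncomputable def imiCorrCoeff {Ω : Type*} [MeasurableSpace Ω] (P : Measure Ω)
    (h : ℝ → Ω → ℂ) (Ts η : ℝ) (l i : ℤ) : ℝ :=
  (imiACF P h Ts η l i - (∫ ω, imi h Ts η l ω ∂P) ^ 2) /
    ((∫ ω, imi h Ts η l ω ^ 2 ∂P) - (∫ ω, imi h Ts η l ω ∂P) ^ 2)

/-- The dilogarithm `Li₂(x) = ∑_{k ≥ 1} x^k / k²`, for `|x| ≤ 1`. -/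
noncomputable def dilog (x : ℝ) : ℝ := ∑' k : ℕ, x ^ (k + 1) / ((k : ℝ) + 1) ^ 2

/-- The constant `γ = 1.781072…`, i.e. `γ = exp C` with `C = 0.5772…` the Euler–Mascheroni
constant in today's convention. -/
noncomputable def gammaConst : ℝ := Real.exp Real.eulerMascheroniConstant

/-!
Frullani's formula `log y = ∫₀^∞ (exp (-u) - exp (-u y)) / u du` reduces a covariance with `log Y`
to the covariances with `exp (-u Y)`, `u > 0`. By circular symmetry, two samples of the channel are
`Z` and `b Z + D` with `‖b‖ = ϱ`, where the innovation `D` is a circular Gaussian independent of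
`Z`. Given `Z`, the Laplace transform of `‖b Z + D‖²` is a Gaussian integral, and `‖Z‖²` is
exponential, so that the covariance of `log ‖Z‖²` with `exp (-u ‖b Z + D‖²)` is
`log (1 - ϱ² u / (1 + u)) / (1 + u)`. Expanding this logarithm and integrating term by term against
`du / u` produces `Li₂ (ϱ²)`.

At high SNR, `log (1 + η X)` is `log η + log X` up to an error that vanishes in `L²`. Hence the
covariance of the mutual informations tends to that of the log-powers, while their mean is
`log (η / γ)` up to `O (η ^ (-1/2))`, which is negligible even when multiplied by `log η`. All
limits follow from these two facts, lag zero being the case `ϱ = 1` with `Li₂ 1 = π² / 6`.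

The generating functions come from Cauchy products with the geometric series, since `H_k` and `H_k²`
are partial sums of `1 / k` and of `2 H_(k-1) / k + 1 / k²`.
-/

section GeneratingFunctions

lemma hasSum_sum_range_mul_pow {𝕜 : Type*} [NormedField 𝕜] [CompleteSpace 𝕜] {a : ℕ → 𝕜} {t S : 𝕜}
    (ht : ‖t‖ < 1) (ha : Summable fun k => ‖a k * t ^ (k + 1)‖)
    (hS : HasSum (fun k => a k * t ^ (k + 1)) S) :
    HasSum (fun k => (∑ j ∈ Finset.range k, a j) * t ^ k) (S / (1 - t)) := by
  have hcauchy := hasSum_sum_range_mul_of_summable_norm ha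
    (summable_norm_geometric_of_norm_lt_one ht)
  rw [hS.tsum_eq, tsum_geometric_of_norm_lt_one ht, ← div_eq_mul_inv] at hcauchy
  refine (hasSum_nat_add_iff' 1).1 ?_
  simp only [Finset.sum_range_one, Finset.range_zero, Finset.sum_empty, zero_mul, sub_zero]
  refine hcauchy.congr_fun fun n => ?_
  rw [Finset.sum_mul]
  refine Finset.sum_congr rfl fun j hj => ?_
  rw [mul_assoc, ← pow_add, show j + 1 + (n - j) = n + 1 by grind]

lemma harmonic_cast_eq_sum_range (k : ℕ) :
    (harmonic k : ℝ) = ∑ j ∈ Finset.range k, 1 / ((j : ℝ) + 1) := by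
  simp [harmonic]

lemma harmonic_sq_cast_eq_sum_range (k : ℕ) :
    (harmonic k : ℝ) ^ 2 =
      ∑ j ∈ Finset.range k, (2 * (harmonic j : ℝ) / (j + 1) + 1 / ((j : ℝ) + 1) ^ 2) := by
  have hstep (j : ℕ) : 2 * (harmonic j : ℝ) / (j + 1) + 1 / ((j : ℝ) + 1) ^ 2 =
      (harmonic (j + 1) : ℝ) ^ 2 - (harmonic j : ℝ) ^ 2 := by
    rw [harmonic_succ]
    push_cast
    field_simp
    ring
  simp only [hstep, Finset.sum_range_sub (fun j => (harmonic j : ℝ) ^ 2), harmonic_zero,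
    Rat.cast_zero]
  ring

lemma hasSum_harmonic_mul_pow {t : ℝ} (ht : |t| < 1) :
    HasSum (fun k : ℕ => (harmonic k : ℝ) * t ^ k) (-Real.log (1 - t) / (1 - t)) := by
  have hlog : HasSum (fun k : ℕ => 1 / ((k : ℝ) + 1) * t ^ (k + 1)) (-Real.log (1 - t)) :=
    (Real.hasSum_pow_div_log_of_abs_lt_one ht).congr_fun fun k => by ring
  simpa only [harmonic_cast_eq_sum_range] using
    hasSum_sum_range_mul_pow ht hlog.summable.norm hlog

lemma sum_range_one_div_mul_one_div (n : ℕ) :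
    ∑ i ∈ Finset.range (n + 1), 1 / ((i : ℝ) + 1) * (1 / (((n - i : ℕ) : ℝ) + 1)) =
      2 * (harmonic (n + 1) : ℝ) / (n + 2) := by
  have hsplit : ∀ i ∈ Finset.range (n + 1), 1 / ((i : ℝ) + 1) * (1 / (((n - i : ℕ) : ℝ) + 1)) =
      (1 / ((i : ℝ) + 1) + 1 / (((n - i : ℕ) : ℝ) + 1)) / (n + 2) := fun i hi => by
    rw [Nat.cast_sub (by grind)]
    have : (i : ℝ) ≤ n := by exact_mod_cast (by grind : i ≤ n)
    field_simp [show (n : ℝ) - i + 1 ≠ 0 by linarith]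
    ring
  have hreflect := Finset.sum_range_reflect (fun i : ℕ => 1 / ((i : ℝ) + 1)) (n + 1)
  simp only [add_tsub_cancel_right] at hreflect
  rw [Finset.sum_congr rfl hsplit, ← Finset.sum_div, Finset.sum_add_distrib, hreflect,
    ← harmonic_cast_eq_sum_range, two_mul]

lemma hasSum_harmonic_mul_pow_div {t : ℝ} (ht : |t| < 1) :
    HasSum (fun k : ℕ => 2 * (harmonic k : ℝ) / (k + 1) * t ^ (k + 1)) (Real.log (1 - t) ^ 2) := by
  have hlog := Real.hasSum_pow_div_log_of_abs_lt_one ht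
  have hcauchy := hasSum_sum_range_mul_of_summable_norm hlog.summable.norm hlog.summable.norm
  rw [hlog.tsum_eq, neg_mul_neg, ← sq] at hcauchy
  refine (hasSum_nat_add_iff' 1).1 ?_
  simp only [Finset.sum_range_one, harmonic_zero, Rat.cast_zero, mul_zero, zero_div, zero_mul,
    sub_zero]
  refine hcauchy.congr_fun fun n => ?_
  have hterm : ∀ i ∈ Finset.range (n + 1),
      t ^ (i + 1) / ((i : ℝ) + 1) * (t ^ (n - i + 1) / (((n - i : ℕ) : ℝ) + 1)) =
        1 / ((i : ℝ) + 1) * (1 / (((n - i : ℕ) : ℝ) + 1)) * t ^ (n + 2) := fun i hi => by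
    rw [show n + 2 = (i + 1) + (n - i + 1) by grind, pow_add]
    ring
  rw [Finset.sum_congr rfl hterm, ← Finset.sum_mul, sum_range_one_div_mul_one_div]
  push_cast
  ring

lemma hasSum_dilog {x : ℝ} (hx : |x| ≤ 1) :
    HasSum (fun k : ℕ => x ^ (k + 1) / ((k : ℝ) + 1) ^ 2) (dilog x) := by
  refine (Summable.of_norm_bounded (g := fun k : ℕ => 1 / ((k : ℝ) + 1) ^ 2) ?_ fun k => ?_).hasSum
  · exact_mod_cast (summable_nat_add_iff 1).2 (Real.summable_one_div_nat_pow.2 one_lt_two)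
  · rw [norm_div, norm_pow, Real.norm_eq_abs, Real.norm_of_nonneg (by positivity)]
    gcongr
    exact pow_le_one₀ (abs_nonneg x) hx

lemma dilog_one : dilog 1 = Real.pi ^ 2 / 6 := by
  refine (hasSum_dilog (by simp)).unique ?_
  simpa using (hasSum_nat_add_iff' 1).2 hasSum_zeta_two

lemma hasSum_harmonic_sq_mul_pow {t : ℝ} (ht : |t| < 1) :
    HasSum (fun k : ℕ => (harmonic k : ℝ) ^ 2 * t ^ k)
      ((dilog t + Real.log (1 - t) ^ 2) / (1 - t)) := by
  have hincr : HasSum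
      (fun k : ℕ => (2 * (harmonic k : ℝ) / (k + 1) + 1 / ((k : ℝ) + 1) ^ 2) * t ^ (k + 1))
      (dilog t + Real.log (1 - t) ^ 2) := by
    rw [add_comm]
    exact ((hasSum_harmonic_mul_pow_div ht).add (hasSum_dilog ht.le)).congr_fun fun k => by ring
  simpa only [harmonic_sq_cast_eq_sum_range] using
    hasSum_sum_range_mul_pow ht hincr.summable.norm hincr

end GeneratingFunctions

section DilogIntegral

open Set

lemma hasDerivAt_div_one_add_pow (k : ℕ) {u : ℝ} (hu : 0 ≤ u) :
    HasDerivAt (fun u : ℝ => (u / (1 + u)) ^ (k + 1) / (k + 1))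
      ((u / (1 + u)) ^ k / (1 + u) ^ 2) u := by
  have hu' : 1 + u ≠ 0 := by positivity
  refine ((((hasDerivAt_id u).fun_div ((hasDerivAt_id u).const_add 1) hu').pow (k + 1)).div_const
    ((k : ℝ) + 1)).congr_deriv ?_
  simp only [id_eq, Nat.add_sub_cancel, Nat.cast_add, Nat.cast_one]
  field_simp
  ring

lemma tendsto_div_one_add_pow_div (k : ℕ) :
    Tendsto (fun u : ℝ => (u / (1 + u)) ^ (k + 1) / (k + 1)) atTop (𝓝 (1 / ((k : ℝ) + 1))) := by
  have hlim : Tendsto (fun u : ℝ => 1 - (1 + u)⁻¹) atTop (𝓝 1) := by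
    simpa using (tendsto_inv_atTop_zero.comp (tendsto_const_nhds (x := (1 : ℝ)).add_atTop
      tendsto_id)).const_sub 1
  have hratio : Tendsto (fun u : ℝ => u / (1 + u)) atTop (𝓝 1) := by
    refine hlim.congr' ?_
    filter_upwards [eventually_ge_atTop 0] with u hu
    field_simp
    ring
  simpa using (hratio.pow (k + 1)).div_const ((k : ℝ) + 1)

lemma integrableOn_div_one_add_pow_div_sq (k : ℕ) :
    IntegrableOn (fun u : ℝ => (u / (1 + u)) ^ k / (1 + u) ^ 2) (Ioi 0) :=
  integrableOn_Ioi_deriv_of_nonneg' (fun _ hu => hasDerivAt_div_one_add_pow k hu)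
    (fun u hu => by have := mem_Ioi.1 hu; positivity) (tendsto_div_one_add_pow_div k)

lemma integral_div_one_add_pow_div_sq (k : ℕ) :
    ∫ u in Ioi (0 : ℝ), (u / (1 + u)) ^ k / (1 + u) ^ 2 = 1 / ((k : ℝ) + 1) := by
  rw [integral_Ioi_of_hasDerivAt_of_nonneg' (fun _ hu => hasDerivAt_div_one_add_pow k hu)
    (fun u hu => by have := mem_Ioi.1 hu; positivity) (tendsto_div_one_add_pow_div k)]
  simp

lemma hasSum_neg_log_one_sub_mul_div {p u : ℝ} (hp : |p| ≤ 1) (hu : 0 < u) :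
    HasSum (fun k : ℕ => p ^ (k + 1) / (k + 1) * ((u / (1 + u)) ^ k / (1 + u) ^ 2))
      (-Real.log (1 - p * (u / (1 + u))) / (u * (1 + u))) := by
  have hlt : |p * (u / (1 + u))| < 1 := by
    rw [abs_mul, abs_of_pos (show 0 < u / (1 + u) by positivity)]
    exact (mul_le_of_le_one_left (by positivity) hp).trans_lt
      ((div_lt_one (by positivity)).2 (by linarith))
  refine ((Real.hasSum_pow_div_log_of_abs_lt_one hlt).div_const _).congr_fun fun k => ?_
  simp only [mul_pow, div_pow]
  field_simp
  ring

lemma integral_neg_log_one_sub_mul_div_eq_dilog {p : ℝ} (hp : |p| ≤ 1) :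
    ∫ u in Ioi (0 : ℝ), -Real.log (1 - p * (u / (1 + u))) / (u * (1 + u)) = dilog p := by
  let F (k : ℕ) (u : ℝ) : ℝ := p ^ (k + 1) / (k + 1) * ((u / (1 + u)) ^ k / (1 + u) ^ 2)
  have hF_int (k : ℕ) : Integrable (F k) (volume.restrict (Ioi 0)) :=
    (integrableOn_div_one_add_pow_div_sq k).const_mul _
  have hF_integral (k : ℕ) : ∫ u in Ioi (0 : ℝ), F k u = p ^ (k + 1) / (k + 1) ^ 2 := by
    simp only [F, integral_const_mul, integral_div_one_add_pow_div_sq]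
    field_simp
  have hF_norm (k : ℕ) : ∫ u in Ioi (0 : ℝ), ‖F k u‖ = |p| ^ (k + 1) / (k + 1) ^ 2 := by
    have hF_abs : ∀ u ∈ Ioi (0 : ℝ), ‖F k u‖ =
        |p| ^ (k + 1) / (k + 1) * ((u / (1 + u)) ^ k / (1 + u) ^ 2) := fun u hu => by
      have := mem_Ioi.1 hu
      rw [norm_mul, norm_div, norm_pow, Real.norm_eq_abs, Real.norm_of_nonneg (by positivity),
        Real.norm_of_nonneg (by positivity)]
    rw [setIntegral_congr_fun measurableSet_Ioi hF_abs, integral_const_mul,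
      integral_div_one_add_pow_div_sq]
    field_simp
  have hsummable : Summable fun k => ∫ u in Ioi (0 : ℝ), ‖F k u‖ := by
    simp only [hF_norm]
    exact (hasSum_dilog (by rwa [abs_abs])).summable
  rw [setIntegral_congr_fun measurableSet_Ioi fun u hu =>
      (hasSum_neg_log_one_sub_mul_div hp hu).tsum_eq.symm, dilog,
    ← (hasSum_integral_of_summable_integral_norm hF_int hsummable).tsum_eq]
  simp only [hF_integral]

end DilogIntegral

section LogCovariance

open Set

lemma abs_exp_neg_sub_exp_neg_le (a b : ℝ) :
    |Real.exp (-a) - Real.exp (-b)| ≤ |a - b| * Real.exp (-min a b) := by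
  wlog hab : a ≤ b generalizing a b
  · rw [abs_sub_comm, abs_sub_comm a, min_comm]
    exact this b a (le_of_not_ge hab)
  have hfactor : Real.exp (-a) - Real.exp (-b) = (1 - Real.exp (-(b - a))) * Real.exp (-a) := by
    rw [sub_mul, ← Real.exp_add]
    ring_nf
  rw [min_eq_left hab, hfactor, abs_mul, Real.abs_exp, abs_sub_comm a, abs_of_nonneg (by simpa),
    abs_of_nonneg (by linarith)]
  refine mul_le_mul_of_nonneg_right ?_ (Real.exp_pos _).le
  linarith [Real.one_sub_le_exp_neg (b - a)]

lemma integrableOn_exp_neg_sub_exp_neg_mul_div {y : ℝ} (hy : 0 < y) :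
    IntegrableOn (fun u : ℝ => (Real.exp (-u) - Real.exp (-(u * y))) / u) (Ioi 0) := by
  have hmeas : Measurable fun u : ℝ => (Real.exp (-u) - Real.exp (-(u * y))) / u := by fun_prop
  refine Integrable.mono' ((integrableOn_exp_mul_Ioi (neg_neg_of_pos (lt_min one_pos hy))
    0).const_mul |1 - y|) hmeas.aestronglyMeasurable ((ae_restrict_iff' measurableSet_Ioi).2
    (ae_of_all _ fun u hu => ?_))
  have hu : 0 < u := hu
  have hbound := abs_exp_neg_sub_exp_neg_le (u * 1) (u * y)
  rw [← mul_sub, abs_mul, abs_of_pos hu, ← mul_min_of_nonneg _ _ hu.le, mul_one] at hbound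
  rw [norm_div, Real.norm_eq_abs, Real.norm_of_nonneg hu.le, div_le_iff₀ hu]
  calc |Real.exp (-u) - Real.exp (-(u * y))|
      ≤ u * |1 - y| * Real.exp (-(u * min 1 y)) := hbound
    _ = |1 - y| * Real.exp (-min 1 y * u) * u := by ring_nf

lemma integral_exp_neg_sub_exp_neg_mul_div {y : ℝ} (hy : 0 < y) :
    ∫ u in Ioi (0 : ℝ), (Real.exp (-u) - Real.exp (-(u * y))) / u = Real.log y := by
  have hcont : Continuous fun x : ℝ => Real.exp (-x) := by fun_prop
  have hint : IntegrableOn (fun u : ℝ => u⁻¹ • (Real.exp (-(1 * u)) - Real.exp (-(y * u))))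
      (Ioi 0) := by
    simpa only [smul_eq_mul, inv_mul_eq_div, one_mul, mul_comm y] using
      integrableOn_exp_neg_sub_exp_neg_mul_div hy
  have hzero : Tendsto (fun x : ℝ => Real.exp (-x)) (𝓝[>] 0) (𝓝 1) := by
    simpa using (hcont.tendsto 0).mono_left nhdsWithin_le_nhds
  have := Frullani.integral_Ioi_eq (hcont.locallyIntegrable.locallyIntegrableOn _) one_pos hy hzero
    Real.tendsto_exp_neg_atTop_nhds_zero hint
  simpa only [smul_eq_mul, inv_mul_eq_div, one_mul, mul_comm y, div_one, sub_zero, mul_one]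
    using this

lemma integral_norm_exp_neg_sub_exp_neg_mul_div {y : ℝ} (hy : 0 < y) :
    ∫ u in Ioi (0 : ℝ), ‖(Real.exp (-u) - Real.exp (-(u * y))) / u‖ = |Real.log y| := by
  rcases le_total 1 y with h1 | h1
  · rw [abs_of_nonneg (Real.log_nonneg h1), ← integral_exp_neg_sub_exp_neg_mul_div hy]
    refine setIntegral_congr_fun measurableSet_Ioi fun u hu => Real.norm_of_nonneg ?_
    refine div_nonneg (sub_nonneg.2 (Real.exp_le_exp.2 (neg_le_neg ?_))) (le_of_lt hu)
    exact le_mul_of_one_le_right (le_of_lt hu) h1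
  · rw [abs_of_nonpos (Real.log_nonpos hy.le h1), ← integral_exp_neg_sub_exp_neg_mul_div hy,
      ← integral_neg]
    refine setIntegral_congr_fun measurableSet_Ioi fun u hu => Real.norm_of_nonpos ?_
    refine div_nonpos_of_nonpos_of_nonneg (sub_nonpos.2 (Real.exp_le_exp.2 (neg_le_neg ?_)))
      (le_of_lt hu)
    exact mul_le_of_le_one_right (le_of_lt hu) h1

variable {Ω : Type*} [MeasurableSpace Ω] {P : Measure Ω} {f g Y : Ω → ℝ}

lemma integrable_prod_mul_exp_neg_sub_exp_neg_div [SFinite P] (hf : AEStronglyMeasurable f P)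
    (hY : AEMeasurable Y P) (hY_pos : ∀ᵐ ω ∂P, 0 < Y ω)
    (hfY : Integrable (fun ω => f ω * Real.log (Y ω)) P) :
    Integrable (fun z : Ω × ℝ => f z.1 * ((Real.exp (-z.2) - Real.exp (-(z.2 * Y z.1))) / z.2))
      (P.prod (volume.restrict (Ioi 0))) := by
  have hmeas : AEMeasurable (fun z : Ω × ℝ =>
      (Real.exp (-z.2) - Real.exp (-(z.2 * Y z.1))) / z.2) (P.prod (volume.restrict (Ioi 0))) := by
    have := hY.comp_fst (ν := volume.restrict (Ioi (0 : ℝ)))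
    fun_prop
  refine (integrable_prod_iff (hf.comp_fst.mul hmeas.aestronglyMeasurable)).2 ⟨?_, ?_⟩
  · filter_upwards [hY_pos] with ω hω
    exact (integrableOn_exp_neg_sub_exp_neg_mul_div hω).const_mul (f ω)
  · refine hfY.norm.congr ?_
    filter_upwards [hY_pos] with ω hω
    simp only [Pi.mul_apply, norm_mul, integral_const_mul,
      integral_norm_exp_neg_sub_exp_neg_mul_div hω, Real.norm_eq_abs (Real.log _)]

lemma ae_norm_exp_neg_mul_le_one (hY_pos : ∀ᵐ ω ∂P, 0 < Y ω) {u : ℝ} (hu : 0 ≤ u) :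
    ∀ᵐ ω ∂P, ‖Real.exp (-(u * Y ω))‖ ≤ 1 := by
  filter_upwards [hY_pos] with ω hω
  rw [Real.norm_eq_abs, Real.abs_exp, Real.exp_le_one_iff, neg_nonpos]
  exact mul_nonneg hu hω.le

lemma integral_mul_log_eq_integral_Ioi [SFinite P] (hf : Integrable f P)
    (hY : AEMeasurable Y P) (hY_pos : ∀ᵐ ω ∂P, 0 < Y ω)
    (hfY : Integrable (fun ω => f ω * Real.log (Y ω)) P) :
    ∫ ω, f ω * Real.log (Y ω) ∂P =
      ∫ u in Ioi (0 : ℝ),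
        (Real.exp (-u) * ∫ ω, f ω ∂P - ∫ ω, f ω * Real.exp (-(u * Y ω)) ∂P) / u := by
  have hexp_int : ∀ u ∈ Ioi (0 : ℝ), Integrable (fun ω => f ω * Real.exp (-(u * Y ω))) P :=
    fun u hu => hf.mul_bdd (by fun_prop) (ae_norm_exp_neg_mul_le_one hY_pos (le_of_lt hu))
  calc ∫ ω, f ω * Real.log (Y ω) ∂P
      = ∫ ω, (∫ u in Ioi (0 : ℝ),
          f ω * ((Real.exp (-u) - Real.exp (-(u * Y ω))) / u)) ∂P := by
        refine integral_congr_ae ?_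
        filter_upwards [hY_pos] with ω hω
        rw [integral_const_mul, integral_exp_neg_sub_exp_neg_mul_div hω]
    _ = ∫ u in Ioi (0 : ℝ), ∫ ω, f ω * ((Real.exp (-u) - Real.exp (-(u * Y ω))) / u) ∂P :=
        integral_integral_swap
          (integrable_prod_mul_exp_neg_sub_exp_neg_div hf.aestronglyMeasurable hY hY_pos hfY)
    _ = _ := by
        refine setIntegral_congr_fun measurableSet_Ioi fun u hu => ?_
        simp only [mul_div_assoc', mul_sub, integral_div]
        rw [integral_sub (hf.mul_const _) (hexp_int u hu), integral_mul_const, mul_comm]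

variable [IsProbabilityMeasure P]

lemma covariance_eq_integral_sub_integral_mul (hf : MemLp f 2 P) (hg : MemLp g 2 P) :
    cov[f, g; P] = ∫ ω, (f ω - ∫ ω, f ω ∂P) * g ω ∂P := by
  rw [covariance_eq_sub hf hg]
  simp only [sub_mul, Pi.mul_apply]
  rw [integral_sub (f := fun ω => f ω * g ω) (hf.integrable_mul hg)
    ((hg.integrable one_le_two).const_mul _), integral_const_mul]

lemma covariance_log_eq_neg_integral_Ioi (hf : MemLp f 2 P) (hY : AEMeasurable Y P)
    (hY_pos : ∀ᵐ ω ∂P, 0 < Y ω) (hlog : MemLp (fun ω => Real.log (Y ω)) 2 P) :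
    cov[f, fun ω => Real.log (Y ω); P] =
      -∫ u in Ioi (0 : ℝ), cov[f, fun ω => Real.exp (-(u * Y ω)); P] / u := by
  have hcentered : MemLp (fun ω => f ω - ∫ ω, f ω ∂P) 2 P := hf.sub (memLp_const _)
  have hmean : ∫ ω, (f ω - ∫ ω, f ω ∂P) ∂P = 0 := by
    simp [integral_sub (hf.integrable one_le_two) (integrable_const _)]
  have hexp : ∀ u ∈ Ioi (0 : ℝ), MemLp (fun ω => Real.exp (-(u * Y ω))) 2 P := fun u hu =>
    MemLp.of_bound (by fun_prop) 1 (ae_norm_exp_neg_mul_le_one hY_pos (le_of_lt hu))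
  rw [covariance_eq_integral_sub_integral_mul hf hlog, integral_mul_log_eq_integral_Ioi
    (hcentered.integrable one_le_two) hY hY_pos (hcentered.integrable_mul hlog), ← integral_neg]
  refine setIntegral_congr_fun measurableSet_Ioi fun u hu => ?_
  simp only [hmean, covariance_eq_integral_sub_integral_mul hf (hexp u hu)]
  ring

end LogCovariance

section ExponentialLaw

open Set

variable {r : ℝ}

lemma expMeasure_eq_withDensity :
    expMeasure r =
      (volume.restrict (Ioi 0)).withDensity fun x => ENNReal.ofReal (r * Real.exp (-(r * x))) := by
  rw [expMeasure, gammaMeasure, Measure.restrict_congr_set Ioi_ae_eq_Ici,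
    ← withDensity_indicator measurableSet_Ici]
  congr with x
  change exponentialPDF r x = _
  by_cases hx : 0 ≤ x <;> simp [exponentialPDF_eq, hx]

lemma integral_expMeasure (hr : 0 < r) (f : ℝ → ℝ) :
    ∫ x, f x ∂expMeasure r = ∫ x in Ioi (0 : ℝ), r * Real.exp (-(r * x)) * f x := by
  rw [expMeasure_eq_withDensity, integral_withDensity_eq_integral_toReal_smul (by fun_prop)
    (ae_of_all _ fun x => ENNReal.ofReal_lt_top)]
  congr with x
  rw [ENNReal.toReal_ofReal (by positivity), smul_eq_mul]

lemma integrable_expMeasure_iff (hr : 0 < r) {f : ℝ → ℝ} :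
    Integrable f (expMeasure r) ↔
      IntegrableOn (fun x => r * Real.exp (-(r * x)) * f x) (Ioi 0) := by
  rw [expMeasure_eq_withDensity, integrable_withDensity_iff_integrable_smul' (by fun_prop)
    (ae_of_all _ fun x => ENNReal.ofReal_lt_top), IntegrableOn]
  refine integrable_congr (ae_of_all _ fun x => ?_)
  beta_reduce
  rw [ENNReal.toReal_ofReal (by positivity), smul_eq_mul]

lemma expMeasure_absolutelyContinuous : expMeasure r ≪ volume.restrict (Ioi 0) :=
  expMeasure_eq_withDensity ▸ withDensity_absolutelyContinuous _ _

lemma ae_pos_expMeasure : ∀ᵐ x ∂expMeasure r, 0 < x :=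
  expMeasure_absolutelyContinuous.ae_le (ae_restrict_mem measurableSet_Ioi)

lemma expMeasure_singleton (x : ℝ) : expMeasure r {x} = 0 :=
  expMeasure_absolutelyContinuous (by simp)

lemma integrable_rpow_expMeasure (hr : 0 < r) {s : ℝ} (hs : -1 < s) :
    Integrable (fun x : ℝ => x ^ s) (expMeasure r) := by
  refine (integrable_expMeasure_iff hr).2 (((integrableOn_rpow_mul_exp_neg_mul_rpow hs one_pos
    hr).const_mul r).congr (ae_of_all _ fun x => ?_))
  simp only [Real.rpow_one, neg_mul]
  ring

lemma memLp_two_rpow_expMeasure (hr : 0 < r) {s : ℝ} (hs : -(1 / 2) < s) :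
    MemLp (fun x : ℝ => x ^ s) 2 (expMeasure r) := by
  rw [memLp_two_iff_integrable_sq (by fun_prop)]
  refine (integrable_rpow_expMeasure hr (s := s * 2) (by linarith)).congr ?_
  filter_upwards [ae_pos_expMeasure] with x hx
  exact_mod_cast Real.rpow_mul_natCast hx.le s 2

lemma abs_log_le_rpow_add_rpow_neg_div {x ε : ℝ} (hx : 0 < x) (hε : 0 < ε) :
    |Real.log x| ≤ (x ^ ε + x ^ (-ε)) / ε := by
  have hupper := Real.log_le_rpow_div hx.le hε
  have hlower := Real.log_le_rpow_div (inv_pos.2 hx).le hε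
  rw [Real.log_inv, Real.inv_rpow hx.le, ← Real.rpow_neg hx.le] at hlower
  have := div_nonneg (Real.rpow_nonneg hx.le ε) hε.le
  have := div_nonneg (Real.rpow_nonneg hx.le (-ε)) hε.le
  rw [add_div, abs_le]
  constructor <;> linarith

lemma memLp_two_log_expMeasure (hr : 0 < r) : MemLp Real.log 2 (expMeasure r) := by
  refine (((memLp_two_rpow_expMeasure hr (s := 1 / 4) (by norm_num)).add
    (memLp_two_rpow_expMeasure hr (s := -(1 / 4)) (by norm_num))).const_mul (1 / 4)⁻¹).mono
      (by fun_prop) ?_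
  filter_upwards [ae_pos_expMeasure] with x hx
  refine (abs_log_le_rpow_add_rpow_neg_div hx (ε := 1 / 4) (by norm_num)).trans ?_
  rw [div_eq_inv_mul]
  exact le_abs_self _

lemma integral_exp_neg_mul_log :
    ∫ x in Ioi (0 : ℝ), Real.exp (-x) * Real.log x = -Real.eulerMascheroniConstant := by
  have hderiv : HasDerivAt Complex.GammaIntegral (-Real.eulerMascheroniConstant : ℂ) 1 := by
    refine Complex.hasDerivAt_Gamma_one.congr_of_eventuallyEq ?_
    filter_upwards [(isOpen_lt continuous_const Complex.continuous_re).mem_nhds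
      (show (0 : ℝ) < (1 : ℂ).re by simp)] with s hs
    exact (Complex.Gamma_eq_integral hs).symm
  have hunique := (Complex.hasDerivAt_GammaIntegral (s := 1) (by simp)).unique hderiv
  simp only [sub_self, Complex.cpow_zero, one_mul, ← Complex.ofReal_mul,
    integral_complex_ofReal] at hunique
  simp_rw [mul_comm (Real.exp _)]
  exact_mod_cast hunique

lemma integral_log_expMeasure (hr : 0 < r) :
    ∫ x, Real.log x ∂expMeasure r = -(Real.eulerMascheroniConstant + Real.log r) := by
  have hlog : IntegrableOn (fun x => Real.exp (-x) * Real.log x) (Ioi 0) := by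
    have := isProbabilityMeasure_expMeasure one_pos
    simpa using (integrable_expMeasure_iff one_pos).1
      ((memLp_two_log_expMeasure one_pos).integrable one_le_two)
  calc ∫ x, Real.log x ∂expMeasure r
      = r * ∫ x in Ioi (0 : ℝ), Real.exp (-(r * x)) * (Real.log (r * x) - Real.log r) := by
        rw [integral_expMeasure hr, ← integral_const_mul]
        refine setIntegral_congr_fun measurableSet_Ioi fun x hx => ?_
        rw [Real.log_mul hr.ne' (ne_of_gt hx)]
        ring
    _ = ∫ y in Ioi (0 : ℝ), Real.exp (-y) * (Real.log y - Real.log r) := by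
        rw [integral_comp_mul_left_Ioi (fun y => Real.exp (-y) * (Real.log y - Real.log r)) 0 hr,
          mul_zero, smul_eq_mul, mul_inv_cancel_left₀ hr.ne']
    _ = -(Real.eulerMascheroniConstant + Real.log r) := by
        simp only [mul_sub]
        rw [integral_sub hlog ((integrableOn_exp_neg_Ioi 0).mul_const _), integral_mul_const,
          integral_exp_neg_mul_log, integral_exp_neg_Ioi_zero]
        ring

lemma integral_mul_exp_neg_expMeasure (hr : 0 < r) {u : ℝ} (hu : 0 ≤ u) (f : ℝ → ℝ) :
    ∫ x, f x * Real.exp (-(u * x)) ∂expMeasure r =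
      r / (r + u) * ∫ x, f x ∂expMeasure (r + u) := by
  rw [integral_expMeasure hr, integral_expMeasure (by positivity), ← integral_const_mul]
  refine setIntegral_congr_fun measurableSet_Ioi fun x _ => ?_
  simp only [add_mul, neg_add, Real.exp_add]
  field_simp

lemma integral_exp_neg_expMeasure (hr : 0 < r) {u : ℝ} (hu : 0 ≤ u) :
    ∫ x, Real.exp (-(u * x)) ∂expMeasure r = r / (r + u) := by
  have := isProbabilityMeasure_expMeasure (r := r + u) (by positivity)
  simpa using integral_mul_exp_neg_expMeasure hr hu fun _ => 1

lemma charFun_expMeasure (hr : 0 < r) (t : ℝ) :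
    charFun (expMeasure r) t = r / (r - t * Complex.I) := by
  have hre : (t * Complex.I - r).re < 0 := by simpa using hr
  rw [charFun_apply_real, expMeasure_eq_withDensity,
    integral_withDensity_eq_integral_toReal_smul (by fun_prop)
      (ae_of_all _ fun x => ENNReal.ofReal_lt_top)]
  calc ∫ x in Ioi (0 : ℝ), (ENNReal.ofReal (r * Real.exp (-(r * x)))).toReal •
        Complex.exp (t * x * Complex.I)
      = ∫ x in Ioi (0 : ℝ), r * Complex.exp ((t * Complex.I - r) * x) := by
        refine setIntegral_congr_fun measurableSet_Ioi fun x _ => ?_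
        rw [ENNReal.toReal_ofReal (by positivity), Complex.real_smul]
        push_cast
        rw [mul_assoc, ← Complex.exp_add]
        ring_nf
    _ = r / (r - t * Complex.I) := by
        rw [integral_const_mul, integral_exp_mul_complex_Ioi hre, Complex.ofReal_zero, mul_zero,
          Complex.exp_zero, ← neg_sub (r : ℂ), neg_div_neg_eq, mul_one_div]

end ExponentialLaw

section CircularGaussian

lemma ofReal_mul_cpow_one_half {r : ℝ} (hr : 0 < r) (z : ℂ) :
    ((r : ℂ) * z) ^ (1 / 2 : ℂ) = ((√r : ℝ) : ℂ) * z ^ (1 / 2 : ℂ) := by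
  rcases eq_or_ne z 0 with rfl | hz
  · simp
  · have hr' : (r : ℂ) ≠ 0 := by exact_mod_cast hr.ne'
    rw [Complex.cpow_def_of_ne_zero (mul_ne_zero hr' hz), Complex.log_ofReal_mul hr hz, add_mul,
      Complex.exp_add, ← Complex.cpow_def_of_ne_zero hz, Real.sqrt_eq_rpow,
      Complex.ofReal_cpow hr.le, Complex.cpow_def_of_ne_zero hr', Complex.ofReal_log hr.le]
    norm_num

lemma one_add_mul_ofReal_ne_zero {b : ℂ} (hb : 0 ≤ b.re) {x : ℝ} (hx : 0 ≤ x) :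
    1 + b * x ≠ 0 := by
  intro h
  have := congrArg Complex.re h
  simp only [Complex.add_re, Complex.one_re, Complex.re_mul_ofReal, Complex.zero_re] at this
  have := mul_nonneg hb hx
  linarith

lemma integral_cexp_neg_mul_sq_gaussianReal_eq_integral {m : ℝ} {v : NNReal} (hv : v ≠ 0) (b : ℂ) :
    ∫ x : ℝ, Complex.exp (-(b * x ^ 2)) ∂gaussianReal m v =
      ((√(2 * Real.pi * v) : ℝ) : ℂ)⁻¹ * ∫ x : ℝ, Complex.exp
        (-((1 + 2 * b * v) / (2 * v)) * x ^ 2 + m / v * x + -(m ^ 2 / (2 * v))) := by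
  have hv' : (v : ℂ) ≠ 0 := by exact_mod_cast hv
  rw [integral_gaussianReal_eq_integral_smul hv, ← integral_const_mul]
  congr with x
  rw [gaussianPDFReal, Complex.real_smul]
  push_cast
  rw [mul_assoc, ← Complex.exp_add]
  congr 2
  field_simp
  ring

lemma integral_cexp_neg_mul_sq_gaussianReal (m : ℝ) (v : NNReal) {b : ℂ} (hb : 0 ≤ b.re) :
    ∫ x : ℝ, Complex.exp (-(b * x ^ 2)) ∂gaussianReal m v =
      (1 + 2 * b * v)⁻¹ ^ (1 / 2 : ℂ) * Complex.exp (-(b * m ^ 2 / (1 + 2 * b * v))) := by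
  rcases eq_or_ne v 0 with rfl | hv
  · simp
  have hv' : (v : ℂ) ≠ 0 := by exact_mod_cast hv
  set d := 1 + 2 * b * v with hd_def
  have hd : d ≠ 0 :=
    one_add_mul_ofReal_ne_zero (b := 2 * b) (by simpa using hb) v.coe_nonneg
  have hb_eq : b = (d - 1) / (2 * v) := by
    rw [hd_def]
    field_simp
    ring
  have hre : (-(d / (2 * v)) : ℂ).re < 0 := by
    have hsplit : d / (2 * v) = ((1 / (2 * v) : ℝ) : ℂ) + b := by
      rw [hd_def]
      push_cast
      field_simp
    have : (0 : ℝ) < 1 / (2 * v) := by positivity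
    rw [hsplit, Complex.neg_re, Complex.add_re, Complex.ofReal_re]
    linarith
  have hexponent : -((m : ℂ) ^ 2 / (2 * v)) - (m / v) ^ 2 / (4 * -(d / (2 * v))) =
      -(b * m ^ 2 / d) := by
    rw [hb_eq]
    field_simp
    ring
  have hbase : (Real.pi : ℂ) / -(-(d / (2 * v))) = (2 * Real.pi * v : ℝ) * d⁻¹ := by
    push_cast
    field_simp
  have hsqrt : ((√(2 * Real.pi * v) : ℝ) : ℂ) ≠ 0 := by
    exact_mod_cast (Real.sqrt_pos.2 (by positivity)).ne'
  rw [integral_cexp_neg_mul_sq_gaussianReal_eq_integral hv, integral_cexp_quadratic hre, hexponent,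
    hbase, ofReal_mul_cpow_one_half (by positivity), mul_assoc (Complex.ofReal _),
    inv_mul_cancel_left₀ hsqrt]

/-- The circularly symmetric complex Gaussian law of mean `0` and power `E|z|² = v`, usually denoted
`𝒞𝒩(0, v)`: the real and imaginary parts are independent, each of variance `v / 2`. -/
noncomputable def circularGaussian (v : NNReal) : Measure ℂ :=
  ((gaussianReal 0 (v / 2)).prod (gaussianReal 0 (v / 2))).map Complex.measurableEquivRealProd.symm

variable {v : NNReal}

instance : IsProbabilityMeasure (circularGaussian v) :=
  Measure.isProbabilityMeasure_map Complex.measurableEquivRealProd.symm.measurable.aemeasurable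

lemma integral_cexp_neg_mul_norm_add_sq_circularGaussian (a : ℂ) {b : ℂ} (hb : 0 ≤ b.re) :
    ∫ z, Complex.exp (-(b * ‖a + z‖ ^ 2)) ∂circularGaussian v =
      (1 + b * v)⁻¹ * Complex.exp (-(b * ‖a‖ ^ 2 / (1 + b * v))) := by
  have hmarginal (x : ℝ) : ∫ y : ℝ, Complex.exp (-(b * ((x + y : ℝ) : ℂ) ^ 2))
      ∂gaussianReal 0 (v / 2) =
        (1 + b * v)⁻¹ ^ (1 / 2 : ℂ) * Complex.exp (-(b * x ^ 2 / (1 + b * v))) := by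
    rw [← integral_map (φ := (x + ·)) (f := fun y : ℝ => Complex.exp (-(b * y ^ 2)))
      (by fun_prop) (by fun_prop), gaussianReal_map_const_add, zero_add,
      integral_cexp_neg_mul_sq_gaussianReal _ _ hb]
    push_cast
    ring_nf
  have hnorm (w : ℂ) : (‖w‖ : ℂ) ^ 2 = (w.re : ℂ) ^ 2 + (w.im : ℂ) ^ 2 := by
    norm_cast
    rw [← Complex.normSq_eq_norm_sq, Complex.normSq_apply, sq, sq]
  rw [circularGaussian, integral_map (by fun_prop) (by fun_prop)]
  calc ∫ z : ℝ × ℝ, Complex.exp (-(b * ‖a + Complex.measurableEquivRealProd.symm z‖ ^ 2))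
        ∂(gaussianReal 0 (v / 2)).prod (gaussianReal 0 (v / 2))
      = ∫ z : ℝ × ℝ, Complex.exp (-(b * ((a.re + z.1 : ℝ) : ℂ) ^ 2)) *
          Complex.exp (-(b * ((a.im + z.2 : ℝ) : ℂ) ^ 2))
        ∂(gaussianReal 0 (v / 2)).prod (gaussianReal 0 (v / 2)) := by
        congr with z
        rw [← Complex.exp_add, hnorm]
        simp only [Complex.measurableEquivRealProd_symm_apply, Complex.add_re, Complex.add_im]
        ring_nf
    _ = (1 + b * v)⁻¹ * Complex.exp (-(b * ‖a‖ ^ 2 / (1 + b * v))) := by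
        rw [integral_prod_mul (fun x : ℝ => Complex.exp (-(b * ((a.re + x : ℝ) : ℂ) ^ 2)))
          (fun y : ℝ => Complex.exp (-(b * ((a.im + y : ℝ) : ℂ) ^ 2))), hmarginal, hmarginal,
          mul_mul_mul_comm, ← Complex.exp_add, hnorm,
          ← Complex.cpow_add _ _ (inv_ne_zero (one_add_mul_ofReal_ne_zero hb v.coe_nonneg)),
          add_halves, Complex.cpow_one]
        ring_nf

lemma integral_exp_neg_mul_norm_add_sq_circularGaussian (a : ℂ) {u : ℝ} (hu : 0 ≤ u) :
    ∫ z, Real.exp (-(u * ‖a + z‖ ^ 2)) ∂circularGaussian v =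
      (1 + u * v)⁻¹ * Real.exp (-(u * ‖a‖ ^ 2 / (1 + u * v))) := by
  have := integral_cexp_neg_mul_norm_add_sq_circularGaussian (v := v) a (b := u) (by simpa using hu)
  rw [← Complex.ofReal_inj, ← integral_complex_ofReal]
  push_cast
  exact this

lemma hasLaw_norm_sq_circularGaussian (hv : v ≠ 0) :
    HasLaw (fun z => ‖z‖ ^ 2) (expMeasure (v : ℝ)⁻¹) (circularGaussian v) where
  aemeasurable := by fun_prop
  map_eq := by
    have hv_pos : 0 < (v : ℝ)⁻¹ := by positivity
    have hv' : (v : ℂ) ≠ 0 := by exact_mod_cast hv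
    have := isProbabilityMeasure_expMeasure hv_pos
    refine Measure.ext_of_charFun (funext fun t => ?_)
    have hre : 0 ≤ (-(t * Complex.I)).re := by simp
    rw [charFun_apply_real, integral_map (by fun_prop) (by fun_prop), charFun_expMeasure hv_pos]
    calc ∫ z, Complex.exp (t * (‖z‖ ^ 2 : ℝ) * Complex.I) ∂circularGaussian v
        = ∫ z, Complex.exp (-(-(t * Complex.I) * ‖0 + z‖ ^ 2)) ∂circularGaussian v := by
          congr with z
          push_cast
          ring_nf
      _ = (v : ℝ)⁻¹ / ((v : ℝ)⁻¹ - t * Complex.I) := by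
          have hfactor : (v : ℂ)⁻¹ - t * Complex.I =
              (v : ℂ)⁻¹ * (1 + -(t * Complex.I) * v) := by
            field_simp
            ring
          rw [integral_cexp_neg_mul_norm_add_sq_circularGaussian 0 hre]
          push_cast
          rw [hfactor, div_mul_cancel_left₀ (inv_ne_zero hv')]
          simp

end CircularGaussian

section CircularSymmetry

variable {Ω : Type*} [MeasurableSpace Ω] {P : Measure Ω} {Z D : Ω → ℂ}

lemma integral_mul_conj_self (D : Ω → ℂ) :
    ∫ ω, D ω * (starRingEnd ℂ) (D ω) ∂P = (∫ ω, ‖D ω‖ ^ 2 ∂P : ℝ) := by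
  simp_rw [Complex.mul_conj', ← Complex.ofReal_pow]
  exact integral_complex_ofReal

lemma integral_re_mul_re_of_integral_mul_self_eq_zero (hD : MemLp D 2 P)
    (hDD : ∫ ω, D ω * D ω ∂P = 0) :
    ∫ ω, (D ω).re * (D ω).re ∂P = (∫ ω, ‖D ω‖ ^ 2 ∂P) / 2 := by
  have hre : ∫ ω, (D ω * D ω).re ∂P = 0 := by
    simpa [hDD] using integral_re (hD.integrable_mul hD)
  have hnorm : Integrable (fun ω => ‖D ω‖ ^ 2) P := hD.norm.integrable_sq
  have hmul : Integrable (fun ω => (D ω * D ω).re) P := (hD.integrable_mul hD).re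
  calc ∫ ω, (D ω).re * (D ω).re ∂P = ∫ ω, (‖D ω‖ ^ 2 + (D ω * D ω).re) / 2 ∂P := by
        congr with ω
        rw [← Complex.normSq_eq_norm_sq, Complex.normSq_apply, Complex.mul_re]
        ring
    _ = (∫ ω, ‖D ω‖ ^ 2 ∂P) / 2 := by
        rw [integral_div, integral_add hnorm hmul, hre, add_zero]

lemma integral_im_mul_im_of_integral_mul_self_eq_zero (hD : MemLp D 2 P)
    (hDD : ∫ ω, D ω * D ω ∂P = 0) :
    ∫ ω, (D ω).im * (D ω).im ∂P = (∫ ω, ‖D ω‖ ^ 2 ∂P) / 2 := by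
  have hiD : MemLp (fun ω => -Complex.I * D ω) 2 P := hD.const_mul _
  have hiDD : ∫ ω, -Complex.I * D ω * (-Complex.I * D ω) ∂P = 0 := by
    simp_rw [mul_mul_mul_comm _ (D _), integral_const_mul, hDD, mul_zero]
  simpa using integral_re_mul_re_of_integral_mul_self_eq_zero hiD hiDD

lemma integral_re_mul_im_of_integral_mul_self_eq_zero (hD : MemLp D 2 P)
    (hDD : ∫ ω, D ω * D ω ∂P = 0) :
    ∫ ω, (D ω).re * (D ω).im ∂P = 0 := by
  have him : ∫ ω, (D ω * D ω).im ∂P = 0 := by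
    simpa [hDD] using integral_im (hD.integrable_mul hD)
  have hdouble (ω : Ω) : (D ω * D ω).im = 2 * ((D ω).re * (D ω).im) := by
    rw [Complex.mul_im]
    ring
  simpa [hdouble, integral_const_mul] using him

theorem hasLaw_circularGaussian (hD : HasGaussianLaw D P) (hmean : ∫ ω, D ω ∂P = 0)
    (hDD : ∫ ω, D ω * D ω ∂P = 0) {v : NNReal} (hv : ∫ ω, ‖D ω‖ ^ 2 ∂P = v) :
    HasLaw D (circularGaussian v) P := by
  have := hD.isProbabilityMeasure
  have hpair : HasGaussianLaw (fun ω => ((D ω).re, (D ω).im)) P :=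
    hD.map_fun Complex.equivRealProdCLM.toContinuousLinearMap
  have hre_mean : ∫ ω, (D ω).re ∂P = 0 := by simpa [hmean] using integral_re hD.integrable
  have him_mean : ∫ ω, (D ω).im ∂P = 0 := by simpa [hmean] using integral_im hD.integrable
  have hcov : cov[fun ω => (D ω).re, fun ω => (D ω).im; P] = 0 := by
    simp [covariance, hre_mean, him_mean,
      integral_re_mul_im_of_integral_mul_self_eq_zero hD.memLp_two hDD]
  have hre : HasLaw (fun ω => (D ω).re) (gaussianReal 0 (v / 2)) P := by
    refine ⟨hpair.fst.aemeasurable, ?_⟩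
    rw [hpair.fst.map_eq_gaussianReal, hre_mean, ← covariance_self hpair.fst.aemeasurable]
    simp [covariance, hre_mean, hv,
      integral_re_mul_re_of_integral_mul_self_eq_zero hD.memLp_two hDD, Real.toNNReal_div]
  have him : HasLaw (fun ω => (D ω).im) (gaussianReal 0 (v / 2)) P := by
    refine ⟨hpair.snd.aemeasurable, ?_⟩
    rw [hpair.snd.map_eq_gaussianReal, him_mean, ← covariance_self hpair.snd.aemeasurable]
    simp [covariance, him_mean, hv,
      integral_im_mul_im_of_integral_mul_self_eq_zero hD.memLp_two hDD, Real.toNNReal_div]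
  have hprod := (hpair.indepFun_of_covariance_eq_zero hcov).hasLaw_prod hre him
  have hsymm : HasLaw Complex.measurableEquivRealProd.symm (circularGaussian v)
      ((gaussianReal 0 (v / 2)).prod (gaussianReal 0 (v / 2))) := ⟨by fun_prop, rfl⟩
  exact hsymm.fun_comp hprod

lemma two_mul_inner_mul_inner (x y z w : ℂ) :
    2 * (inner ℝ x z * inner ℝ y w) =
      ((starRingEnd ℂ) x * (starRingEnd ℂ) y * (z * w) +
        (starRingEnd ℂ) x * y * (z * (starRingEnd ℂ) w)).re := by
  simp only [Complex.inner, Complex.add_re, Complex.mul_re, Complex.mul_im, Complex.conj_re,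
    Complex.conj_im]
  ring

lemma indepFun_of_integral_mul_eq_zero (hZD : HasGaussianLaw (fun ω => (Z ω, D ω)) P)
    (hmean : ∫ ω, Z ω ∂P = 0) (hmul : ∫ ω, Z ω * D ω ∂P = 0)
    (hmul_conj : ∫ ω, Z ω * (starRingEnd ℂ) (D ω) ∂P = 0) : IndepFun Z D P := by
  have := hZD.isProbabilityMeasure
  have hZ := hZD.fst.memLp_two
  have hD := hZD.snd.memLp_two
  refine hZD.indepFun_of_covariance_inner fun x y => ?_
  have hx : ∫ ω, inner ℝ x (Z ω) ∂P = 0 := by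
    rw [integral_inner hZD.fst.integrable, hmean, inner_zero_right]
  rw [covariance_eq_sub (hZ.const_inner x) (hD.const_inner y), hx, zero_mul, sub_zero]
  have hint : Integrable (fun ω => (starRingEnd ℂ) x * (starRingEnd ℂ) y * (Z ω * D ω)) P :=
    (hZ.integrable_mul hD).const_mul _
  have hint_conj : Integrable
      (fun ω => (starRingEnd ℂ) x * y * (Z ω * (starRingEnd ℂ) (D ω))) P :=
    (hZ.integrable_mul hD.star).const_mul _
  have hsum := integral_re (hint.add hint_conj)
  simp only [Pi.add_apply, RCLike.re_to_complex, ← two_mul_inner_mul_inner] at hsum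
  rw [integral_const_mul, integral_add hint hint_conj, integral_const_mul, integral_const_mul, hmul,
    hmul_conj] at hsum
  simpa using hsum

end CircularSymmetry

section CorrelatedPowers

variable {Ω : Type*} [MeasurableSpace Ω] {P : Measure Ω} {Z D : Ω → ℂ}

lemma integral_mul_exp_neg_mul_norm_add_sq {ν : Measure ℂ} [IsFiniteMeasure ν] {v : NNReal}
    (hZ : HasLaw Z ν P) (hD : HasLaw D (circularGaussian v) P) (hZD : IndepFun Z D P) {f : ℂ → ℝ}
    (hf : Integrable f ν) (b : ℂ) {u : ℝ} (hu : 0 ≤ u) :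
    ∫ ω, f (Z ω) * Real.exp (-(u * ‖b * Z ω + D ω‖ ^ 2)) ∂P =
      (1 + u * v)⁻¹ * ∫ z, f z * Real.exp (-(u * ‖b‖ ^ 2 / (1 + u * v) * ‖z‖ ^ 2)) ∂ν := by
  have := hD.isProbabilityMeasure
  have hint : Integrable (fun x : ℂ × ℂ => f x.1 * Real.exp (-(u * ‖b * x.1 + x.2‖ ^ 2)))
      (ν.prod (circularGaussian v)) := by
    refine (hf.comp_fst _).mul_bdd (c := 1) (by fun_prop) (ae_of_all _ fun x => ?_)
    rw [Real.norm_eq_abs, Real.abs_exp, Real.exp_le_one_iff, neg_nonpos]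
    positivity
  have hlaw := (hZD.hasLaw_prod hZ hD).integral_comp hint.aestronglyMeasurable
  rw [Function.comp_def] at hlaw
  rw [hlaw, integral_prod _ hint, ← integral_const_mul]
  congr with z
  simp only
  rw [integral_const_mul, integral_exp_neg_mul_norm_add_sq_circularGaussian _ hu, norm_mul, mul_pow]
  ring_nf

lemma hasLaw_norm_sq_circularGaussian_one (hZ : HasLaw Z (circularGaussian 1) P) :
    HasLaw (fun ω => ‖Z ω‖ ^ 2) (expMeasure 1) P := by
  simpa using (hasLaw_norm_sq_circularGaussian one_ne_zero).fun_comp hZ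

lemma memLp_two_log_of_hasLaw_expMeasure {X : Ω → ℝ} {r : ℝ} (hr : 0 < r)
    (hX : HasLaw X (expMeasure r) P) : MemLp (fun ω => Real.log (X ω)) 2 P :=
  MemLp.comp_of_map (g := Real.log) (hX.map_eq ▸ memLp_two_log_expMeasure hr) hX.aemeasurable

lemma integral_log_of_hasLaw_expMeasure {X : Ω → ℝ} {r : ℝ} (hr : 0 < r)
    (hX : HasLaw X (expMeasure r) P) :
    ∫ ω, Real.log (X ω) ∂P = -(Real.eulerMascheroniConstant + Real.log r) :=
  (hX.integral_comp (f := Real.log) (by fun_prop)).trans (integral_log_expMeasure hr)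

lemma integral_log_mul_exp_neg_expMeasure_one {c : ℝ} (hc : 0 ≤ c) :
    ∫ x, Real.log x * Real.exp (-(c * x)) ∂expMeasure 1 =
      -(Real.eulerMascheroniConstant + Real.log (1 + c)) / (1 + c) := by
  rw [integral_mul_exp_neg_expMeasure one_pos hc, integral_log_expMeasure (by positivity)]
  ring

lemma integral_log_norm_sq_mul_exp_neg_mul_norm_sq {b : ℂ} {q : NNReal} (hbq : ‖b‖ ^ 2 + q = 1)
    (hZ : HasLaw Z (circularGaussian 1) P) (hD : HasLaw D (circularGaussian q) P)
    (hZD : IndepFun Z D P) {u : ℝ} (hu : 0 ≤ u) :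
    ∫ ω, Real.log (‖Z ω‖ ^ 2) * Real.exp (-(u * ‖b * Z ω + D ω‖ ^ 2)) ∂P =
      (Real.log (1 - ‖b‖ ^ 2 * (u / (1 + u))) - Real.eulerMascheroniConstant) / (1 + u) := by
  have hlaw := hasLaw_norm_sq_circularGaussian_one .id
  have hlog := (memLp_two_log_of_hasLaw_expMeasure one_pos hlaw).integrable one_le_two
  set c := u * ‖b‖ ^ 2 / (1 + u * q) with hc_def
  have hmul : (1 + u * q) * (1 + c) = 1 + u := by
    rw [hc_def]
    field_simp
    linear_combination u * hbq
  have hinv : 1 - ‖b‖ ^ 2 * (u / (1 + u)) = (1 + c)⁻¹ := by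
    have hc : 1 + c ≠ 0 := by positivity
    field_simp
    linear_combination hmul - u * (1 + c) * hbq
  have hcomp := hlaw.integral_comp (f := fun x => Real.log x * Real.exp (-(c * x))) (by fun_prop)
  simp only [Function.comp_def, id] at hcomp hlog
  rw [integral_mul_exp_neg_mul_norm_add_sq hZ hD hZD hlog b hu, hcomp,
    integral_log_mul_exp_neg_expMeasure_one (by positivity), hinv, Real.log_inv, ← hmul]
  field_simp
  ring

lemma covariance_log_norm_sq_exp_neg_mul_norm_sq {b : ℂ} {q : NNReal} (hbq : ‖b‖ ^ 2 + q = 1)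
    (hZ : HasLaw Z (circularGaussian 1) P) (hD : HasLaw D (circularGaussian q) P)
    (hW : HasLaw (fun ω => b * Z ω + D ω) (circularGaussian 1) P) (hZD : IndepFun Z D P)
    {u : ℝ} (hu : 0 ≤ u) :
    cov[fun ω => Real.log (‖Z ω‖ ^ 2), fun ω => Real.exp (-(u * ‖b * Z ω + D ω‖ ^ 2)); P] =
      Real.log (1 - ‖b‖ ^ 2 * (u / (1 + u))) / (1 + u) := by
  have := hZ.isProbabilityMeasure
  have hX := hasLaw_norm_sq_circularGaussian_one hZ
  have hY := hasLaw_norm_sq_circularGaussian_one hW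
  have hexp : MemLp (fun ω => Real.exp (-(u * ‖b * Z ω + D ω‖ ^ 2))) 2 P := by
    refine MemLp.of_bound (hY.aemeasurable.const_mul u).neg.exp.aestronglyMeasurable 1
      (ae_of_all _ fun ω => ?_)
    rw [Real.norm_eq_abs, Real.abs_exp, Real.exp_le_one_iff, neg_nonpos]
    positivity
  have hmean_log : ∫ ω, Real.log (‖Z ω‖ ^ 2) ∂P = -Real.eulerMascheroniConstant := by
    simpa using integral_log_of_hasLaw_expMeasure one_pos hX
  have hmean_exp : ∫ ω, Real.exp (-(u * ‖b * Z ω + D ω‖ ^ 2)) ∂P = 1 / (1 + u) := by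
    rw [← integral_exp_neg_expMeasure one_pos hu]
    exact hY.integral_comp (f := fun x => Real.exp (-(u * x))) (by fun_prop)
  rw [covariance_eq_sub (memLp_two_log_of_hasLaw_expMeasure one_pos hX) hexp, hmean_log, hmean_exp]
  simp only [Pi.mul_apply]
  rw [integral_log_norm_sq_mul_exp_neg_mul_norm_sq hbq hZ hD hZD hu]
  ring

theorem covariance_log_norm_sq_log_norm_sq {b : ℂ} {q : NNReal} (hbq : ‖b‖ ^ 2 + q = 1)
    (hZ : HasLaw Z (circularGaussian 1) P) (hD : HasLaw D (circularGaussian q) P)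
    (hW : HasLaw (fun ω => b * Z ω + D ω) (circularGaussian 1) P) (hZD : IndepFun Z D P) :
    cov[fun ω => Real.log (‖Z ω‖ ^ 2), fun ω => Real.log (‖b * Z ω + D ω‖ ^ 2); P] =
      dilog (‖b‖ ^ 2) := by
  have := hZ.isProbabilityMeasure
  have hX := hasLaw_norm_sq_circularGaussian_one hZ
  have hY := hasLaw_norm_sq_circularGaussian_one hW
  have hp : |‖b‖ ^ 2| ≤ 1 := by
    rw [abs_of_nonneg (by positivity)]
    linarith [q.coe_nonneg]
  have hY_pos : ∀ᵐ ω ∂P, 0 < ‖b * Z ω + D ω‖ ^ 2 :=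
    (hY.ae_iff (by fun_prop)).2 ae_pos_expMeasure
  rw [covariance_log_eq_neg_integral_Ioi (memLp_two_log_of_hasLaw_expMeasure one_pos hX)
    hY.aemeasurable hY_pos (memLp_two_log_of_hasLaw_expMeasure one_pos hY),
    ← integral_neg_log_one_sub_mul_div_eq_dilog hp, ← integral_neg]
  refine setIntegral_congr_fun measurableSet_Ioi fun u hu => ?_
  rw [covariance_log_norm_sq_exp_neg_mul_norm_sq hbq hZ hD hW hZD (Set.mem_Ioi.1 hu).le,
    div_div, neg_div, mul_comm u]

end CorrelatedPowers

section Innovation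

open ComplexConjugate

/-- The innovation at time `t - τ`: the residual of the best linear prediction of `h (t - τ)` by
`h t`, for a unit-power process `h` with correlation function `ρh`. -/
noncomputable def innovation {Ω : Type*} (h : ℝ → Ω → ℂ) (ρh : ℝ → ℂ) (t τ : ℝ) (ω : Ω) : ℂ :=
  h (t - τ) ω - conj (ρh τ) * h t ω

lemma mul_add_innovation {Ω : Type*} (h : ℝ → Ω → ℂ) (ρh : ℝ → ℂ) (t τ : ℝ) (ω : Ω) :
    conj (ρh τ) * h t ω + innovation h ρh t τ ω = h (t - τ) ω := by
  rw [innovation, add_sub_cancel]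

namespace IsRayleighFading

variable {Ω : Type*} [MeasurableSpace Ω] {P : Measure Ω} {h : ℝ → Ω → ℂ} {ρh : ℝ → ℂ}

lemma memLp_two (hh : IsRayleighFading P h ρh) (t : ℝ) : MemLp (h t) 2 P :=
  (hh.gaussian.hasGaussianLaw_eval t).memLp_two

lemma memLp_two_innovation (hh : IsRayleighFading P h ρh) (t τ : ℝ) :
    MemLp (innovation h ρh t τ) 2 P :=
  (hh.memLp_two (t - τ)).sub ((hh.memLp_two t).const_mul _)

lemma hasLaw (hh : IsRayleighFading P h ρh) (t : ℝ) : HasLaw (h t) (circularGaussian 1) P :=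
  hasLaw_circularGaussian (hh.gaussian.hasGaussianLaw_eval t) (hh.zero_mean t) (hh.circular t t)
    (hh.unit_power t)

lemma integral_mul_conj_self (hh : IsRayleighFading P h ρh) (t : ℝ) :
    ∫ ω, h t ω * conj (h t ω) ∂P = 1 := by
  rw [_root_.integral_mul_conj_self, hh.unit_power, Complex.ofReal_one]

lemma correlation_zero (hh : IsRayleighFading P h ρh) : ρh 0 = 1 := by
  rw [← hh.correlation 0 0, sub_zero, hh.integral_mul_conj_self]

lemma integral_innovation (hh : IsRayleighFading P h ρh) (t τ : ℝ) :
    ∫ ω, innovation h ρh t τ ω ∂P = 0 := by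
  have hint (s : ℝ) : Integrable (h s) P := (hh.gaussian.hasGaussianLaw_eval s).integrable
  simp only [innovation]
  rw [integral_sub (hint _) ((hint t).const_mul _), integral_const_mul, hh.zero_mean,
    hh.zero_mean, mul_zero, sub_zero]

lemma integral_mul_innovation_eq (hh : IsRayleighFading P h ρh) {F : Ω → ℂ} (hF : MemLp F 2 P)
    (t τ : ℝ) : ∫ ω, F ω * innovation h ρh t τ ω ∂P =
      ∫ ω, F ω * h (t - τ) ω ∂P - conj (ρh τ) * ∫ ω, F ω * h t ω ∂P := by
  have hint (s : ℝ) : Integrable (fun ω => F ω * h s ω) P := hF.integrable_mul (hh.memLp_two s)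
  rw [← integral_const_mul, ← integral_sub (hint _) ((hint t).const_mul _)]
  congr with ω
  rw [innovation]
  ring

lemma integral_mul_conj_innovation_eq (hh : IsRayleighFading P h ρh) {F : Ω → ℂ}
    (hF : MemLp F 2 P) (t τ : ℝ) : ∫ ω, F ω * conj (innovation h ρh t τ ω) ∂P =
      ∫ ω, F ω * conj (h (t - τ) ω) ∂P - ρh τ * ∫ ω, F ω * conj (h t ω) ∂P := by
  have hint (s : ℝ) : Integrable (fun ω => F ω * conj (h s ω)) P :=
    hF.integrable_mul (hh.memLp_two s).star
  rw [← integral_const_mul, ← integral_sub (hint _) ((hint t).const_mul _)]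
  congr with ω
  rw [innovation, map_sub, map_mul, Complex.conj_conj]
  ring

lemma integral_mul_innovation (hh : IsRayleighFading P h ρh) (s t τ : ℝ) :
    ∫ ω, h s ω * innovation h ρh t τ ω ∂P = 0 := by
  rw [hh.integral_mul_innovation_eq (hh.memLp_two s), hh.circular, hh.circular, mul_zero, sub_zero]

lemma integral_mul_conj_innovation (hh : IsRayleighFading P h ρh) (t τ : ℝ) :
    ∫ ω, h t ω * conj (innovation h ρh t τ ω) ∂P = 0 := by
  rw [hh.integral_mul_conj_innovation_eq (hh.memLp_two t), hh.correlation,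
    hh.integral_mul_conj_self, mul_one, sub_self]

lemma integral_innovation_mul_self (hh : IsRayleighFading P h ρh) (t τ : ℝ) :
    ∫ ω, innovation h ρh t τ ω * innovation h ρh t τ ω ∂P = 0 := by
  rw [hh.integral_mul_innovation_eq (hh.memLp_two_innovation t τ)]
  simp only [mul_comm (innovation h ρh t τ _), hh.integral_mul_innovation, mul_zero, sub_zero]

lemma norm_sq_add_integral_norm_sq_innovation (hh : IsRayleighFading P h ρh) (t τ : ℝ) :
    ‖ρh τ‖ ^ 2 + ∫ ω, ‖innovation h ρh t τ ω‖ ^ 2 ∂P = 1 := by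
  set D := innovation h ρh t τ
  have hexpand (ω : Ω) : ‖h (t - τ) ω‖ ^ 2 =
      ‖ρh τ‖ ^ 2 * ‖h t ω‖ ^ 2 + ‖D ω‖ ^ 2 + 2 * (conj (ρh τ) * (h t ω * conj (D ω))).re := by
    rw [← mul_add_innovation h ρh, ← Complex.normSq_eq_norm_sq, Complex.normSq_add,
      ← mul_assoc, map_mul, Complex.normSq_conj]
    simp only [Complex.normSq_eq_norm_sq, D]
  have hZ : Integrable (fun ω => ‖h t ω‖ ^ 2) P := (hh.memLp_two t).norm.integrable_sq
  have hD : Integrable (fun ω => ‖D ω‖ ^ 2) P := (hh.memLp_two_innovation t τ).norm.integrable_sq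
  have hsum : Integrable (fun ω => ‖ρh τ‖ ^ 2 * ‖h t ω‖ ^ 2 + ‖D ω‖ ^ 2) P :=
    (hZ.const_mul _).add hD
  have hZD : Integrable (fun ω => conj (ρh τ) * (h t ω * conj (D ω))) P :=
    ((hh.memLp_two t).integrable_mul (hh.memLp_two_innovation t τ).star).const_mul _
  have hre : Integrable (fun ω => (conj (ρh τ) * (h t ω * conj (D ω))).re) P := hZD.re
  have hcross : ∫ ω, (conj (ρh τ) * (h t ω * conj (D ω))).re ∂P = 0 := by
    refine (integral_re hZD).trans ?_
    rw [integral_const_mul, hh.integral_mul_conj_innovation, mul_zero, map_zero]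
  have hpower := hh.unit_power (t - τ)
  simp_rw [hexpand] at hpower
  rwa [integral_add hsum (hre.const_mul 2),
    integral_add (hZ.const_mul _) hD, integral_const_mul, integral_const_mul, hh.unit_power,
    mul_one, hcross, mul_zero, add_zero] at hpower

lemma hasGaussianLaw_prodMk_innovation (hh : IsRayleighFading P h ρh) (t τ : ℝ) :
    HasGaussianLaw (fun ω => (h t ω, innovation h ρh t τ ω)) P :=
  (hh.gaussian.hasGaussianLaw_prodMk (s := t) (t := t - τ)).map_fun
    ((ContinuousLinearMap.fst ℝ ℂ ℂ).prod (ContinuousLinearMap.snd ℝ ℂ ℂ -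
      (ContinuousLinearMap.mul ℝ ℂ (conj (ρh τ))).comp (ContinuousLinearMap.fst ℝ ℂ ℂ)))

lemma indepFun_innovation (hh : IsRayleighFading P h ρh) (t τ : ℝ) :
    IndepFun (h t) (innovation h ρh t τ) P :=
  indepFun_of_integral_mul_eq_zero (hh.hasGaussianLaw_prodMk_innovation t τ) (hh.zero_mean t)
    (hh.integral_mul_innovation t t τ) (hh.integral_mul_conj_innovation t τ)

theorem covariance_log_norm_sq (hh : IsRayleighFading P h ρh) (t τ : ℝ) :
    cov[fun ω => Real.log (‖h t ω‖ ^ 2), fun ω => Real.log (‖h (t - τ) ω‖ ^ 2); P] =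
      dilog (‖ρh τ‖ ^ 2) := by
  have hpower := hh.norm_sq_add_integral_norm_sq_innovation t τ
  lift ∫ ω, ‖innovation h ρh t τ ω‖ ^ 2 ∂P to NNReal using by positivity with q hq
  have hD : HasLaw (innovation h ρh t τ) (circularGaussian q) P :=
    hasLaw_circularGaussian (hh.hasGaussianLaw_prodMk_innovation t τ).snd
      (hh.integral_innovation t τ) (hh.integral_innovation_mul_self t τ) hq.symm
  have hcov := covariance_log_norm_sq_log_norm_sq (b := conj (ρh τ))
    (by rwa [RCLike.norm_conj]) (hh.hasLaw t) hD
    (by simpa only [mul_add_innovation] using hh.hasLaw (t - τ)) (hh.indepFun_innovation t τ)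
  simpa only [mul_add_innovation, RCLike.norm_conj] using hcov

end IsRayleighFading

end Innovation

section HighSNR

open Asymptotics

variable {Ω : Type*} [MeasurableSpace Ω] {P : Measure Ω} {X Y : Ω → ℝ}

lemma covariance_congr_ae {X' Y' : Ω → ℝ} (hX : X =ᵐ[P] X') (hY : Y =ᵐ[P] Y') :
    cov[X, Y; P] = cov[X', Y'; P] := by
  rw [covariance, covariance, integral_congr_ae hX, integral_congr_ae hY]
  refine integral_congr_ae ?_
  filter_upwards [hX, hY] with ω hXω hYω
  rw [hXω, hYω]

lemma tendsto_covariance_of_dominated [IsProbabilityMeasure P] {ι : Type*} {l : Filter ι}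
    [l.IsCountablyGenerated] {F G : ι → Ω → ℝ} {f g bF bG : Ω → ℝ} (hf : MemLp f 2 P)
    (hg : MemLp g 2 P) (hbF : MemLp bF 2 P) (hbG : MemLp bG 2 P)
    (hF_meas : ∀ n, AEStronglyMeasurable (F n) P) (hG_meas : ∀ n, AEStronglyMeasurable (G n) P)
    (hF_le : ∀ᶠ n in l, ∀ᵐ ω ∂P, ‖F n ω‖ ≤ bF ω) (hG_le : ∀ᶠ n in l, ∀ᵐ ω ∂P, ‖G n ω‖ ≤ bG ω)
    (hF : ∀ᵐ ω ∂P, Tendsto (fun n => F n ω) l (𝓝 (f ω)))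
    (hG : ∀ᵐ ω ∂P, Tendsto (fun n => G n ω) l (𝓝 (g ω))) :
    Tendsto (fun n => cov[F n, G n; P]) l (𝓝 cov[f, g; P]) := by
  have hmul : Tendsto (fun n => ∫ ω, F n ω * G n ω ∂P) l (𝓝 (∫ ω, f ω * g ω ∂P)) := by
    refine tendsto_integral_filter_of_dominated_convergence (fun ω => bF ω * bG ω)
      (.of_forall fun n => (hF_meas n).mul (hG_meas n)) ?_ (hbF.integrable_mul hbG) ?_
    · filter_upwards [hF_le, hG_le] with n hFn hGn
      filter_upwards [hFn, hGn] with ω hFω hGω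
      rw [norm_mul]
      exact mul_le_mul hFω hGω (norm_nonneg _) ((norm_nonneg _).trans hFω)
    · filter_upwards [hF, hG] with ω hFω hGω using hFω.mul hGω
  have hmean_F := tendsto_integral_filter_of_dominated_convergence bF (.of_forall hF_meas) hF_le
    (hbF.integrable one_le_two) hF
  have hmean_G := tendsto_integral_filter_of_dominated_convergence bG (.of_forall hG_meas) hG_le
    (hbG.integrable one_le_two) hG
  rw [covariance_eq_sub hf hg]
  refine (hmul.sub (hmean_F.mul hmean_G)).congr' ?_
  filter_upwards [hF_le, hG_le] with n hFn hGn
  rw [covariance_eq_sub (hbF.of_le (hF_meas n) ?_) (hbG.of_le (hG_meas n) ?_)]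
  · rfl
  · filter_upwards [hFn] with ω hω using hω.trans (Real.le_norm_self _)
  · filter_upwards [hGn] with ω hω using hω.trans (Real.le_norm_self _)

lemma log_one_add_mul_eq_log_add_log {η x : ℝ} (hη : 0 < η) (hx : 0 ≤ x) :
    Real.log (1 + η * x) = Real.log η + Real.log (η⁻¹ + x) := by
  rw [← Real.log_mul hη.ne' (by positivity), mul_add, mul_inv_cancel₀ hη.ne']

lemma abs_log_add_le {ε x : ℝ} (hε : 0 < ε) (hε_le : ε ≤ 1) (hx : 0 < x) :
    |Real.log (ε + x)| ≤ |Real.log x| + x := by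
  have hle := Real.log_le_log hx (le_add_of_nonneg_left hε.le)
  have hsub := Real.log_le_sub_one_of_pos (add_pos hε hx)
  rw [abs_le]
  constructor <;> linarith [neg_abs_le (Real.log x), abs_nonneg (Real.log x)]

lemma ae_norm_log_inv_add_le (hX_pos : ∀ᵐ ω ∂P, 0 < X ω) {η : ℝ} (hη : 1 ≤ η) :
    ∀ᵐ ω ∂P, ‖Real.log (η⁻¹ + X ω)‖ ≤ |Real.log (X ω)| + X ω := by
  filter_upwards [hX_pos] with ω hω
  exact abs_log_add_le (by positivity) (inv_le_one_of_one_le₀ hη) hω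

lemma ae_tendsto_log_inv_add (hX_pos : ∀ᵐ ω ∂P, 0 < X ω) :
    ∀ᵐ ω ∂P, Tendsto (fun η : ℝ => Real.log (η⁻¹ + X ω)) atTop (𝓝 (Real.log (X ω))) := by
  filter_upwards [hX_pos] with ω hω
  refine Tendsto.log ?_ hω.ne'
  simpa using tendsto_inv_atTop_zero.add_const (X ω)

theorem tendsto_covariance_log_one_add_mul [IsProbabilityMeasure P] (hX : MemLp X 2 P)
    (hY : MemLp Y 2 P) (hX_pos : ∀ᵐ ω ∂P, 0 < X ω) (hY_pos : ∀ᵐ ω ∂P, 0 < Y ω)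
    (hX_log : MemLp (fun ω => Real.log (X ω)) 2 P)
    (hY_log : MemLp (fun ω => Real.log (Y ω)) 2 P) :
    Tendsto (fun η : ℝ => cov[fun ω => Real.log (1 + η * X ω), fun ω => Real.log (1 + η * Y ω); P])
      atTop (𝓝 cov[fun ω => Real.log (X ω), fun ω => Real.log (Y ω); P]) := by
  have hmeas {V : Ω → ℝ} (hV : MemLp V 2 P) (η : ℝ) :
      AEStronglyMeasurable (fun ω => Real.log (η⁻¹ + V ω)) P :=
    (hV.aemeasurable.const_add η⁻¹).log.aestronglyMeasurable
  have hint {V : Ω → ℝ} (hV : MemLp V 2 P) (hV_pos : ∀ᵐ ω ∂P, 0 < V ω)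
      (hV_log : MemLp (fun ω => Real.log (V ω)) 2 P) {η : ℝ} (hη : 1 ≤ η) :
      Integrable (fun ω => Real.log (η⁻¹ + V ω)) P :=
    ((hV_log.abs.add hV).integrable one_le_two).mono' (hmeas hV η)
      (ae_norm_log_inv_add_le hV_pos hη)
  have hshift {V : Ω → ℝ} (hV_pos : ∀ᵐ ω ∂P, 0 < V ω) {η : ℝ} (hη : 1 ≤ η) :
      (fun ω => Real.log (1 + η * V ω)) =ᵐ[P] fun ω => Real.log η + Real.log (η⁻¹ + V ω) := by
    filter_upwards [hV_pos] with ω hω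
    exact log_one_add_mul_eq_log_add_log (by positivity) hω.le
  have hlim := tendsto_covariance_of_dominated hX_log hY_log (hX_log.abs.add hX)
    (hY_log.abs.add hY) (hmeas hX) (hmeas hY)
    ((eventually_ge_atTop 1).mono fun _ => ae_norm_log_inv_add_le hX_pos)
    ((eventually_ge_atTop 1).mono fun _ => ae_norm_log_inv_add_le hY_pos)
    (ae_tendsto_log_inv_add hX_pos) (ae_tendsto_log_inv_add hY_pos)
  refine hlim.congr' ?_
  filter_upwards [eventually_ge_atTop 1] with η hη
  rw [covariance_congr_ae (hshift hX_pos hη) (hshift hY_pos hη),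
    covariance_const_add_left (hint hX hX_pos hX_log hη),
    covariance_const_add_right (hint hY hY_pos hY_log hη)]

lemma log_one_add_le_rpow_div {u s : ℝ} (hu : 0 ≤ u) (hs : 0 < s) (hs_le : s ≤ 1) :
    Real.log (1 + u) ≤ u ^ s / s := by
  rw [le_div_iff₀ hs, mul_comm, ← Real.log_rpow (by positivity)]
  have hadd := Real.rpow_add_le_add_rpow zero_le_one hu hs.le hs_le
  rw [Real.one_rpow] at hadd
  linarith [Real.log_le_log (by positivity) hadd,
    Real.log_le_sub_one_of_pos (by positivity : 0 < 1 + u ^ s)]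

lemma abs_log_one_add_mul_sub_le {η x s : ℝ} (hη : 0 < η) (hx : 0 < x) (hs : 0 < s)
    (hs_le : s ≤ 1) :
    |Real.log (1 + η * x) - (Real.log η + Real.log x)| ≤ η ^ (-s) * (x ^ (-s) / s) := by
  have hlog : Real.log (1 + η * x) - (Real.log η + Real.log x) = Real.log (1 + (η * x)⁻¹) := by
    rw [← Real.log_mul hη.ne' hx.ne', ← Real.log_div (by positivity) (by positivity)]
    congr 1
    field_simp
    ring
  rw [hlog, abs_of_nonneg (Real.log_nonneg (le_add_of_nonneg_right (by positivity)))]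
  refine (log_one_add_le_rpow_div (by positivity) hs hs_le).trans_eq ?_
  rw [Real.inv_rpow (by positivity), ← Real.rpow_neg (by positivity), Real.mul_rpow hη.le hx.le,
    mul_div_assoc]

theorem isBigO_integral_log_one_add_mul_sub [IsProbabilityMeasure P] (hX : AEMeasurable X P)
    (hX_pos : ∀ᵐ ω ∂P, 0 < X ω) (hX_log : Integrable (fun ω => Real.log (X ω)) P) {s : ℝ}
    (hs : 0 < s) (hs_le : s ≤ 1) (hX_rpow : Integrable (fun ω => X ω ^ (-s)) P) :
    (fun η : ℝ => ∫ ω, Real.log (1 + η * X ω) ∂P - (Real.log η + ∫ ω, Real.log (X ω) ∂P))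
      =O[atTop] fun η : ℝ => η ^ (-s) := by
  refine IsBigO.of_bound (∫ ω, X ω ^ (-s) / s ∂P) ?_
  filter_upwards [eventually_gt_atTop 0] with η hη
  set d : Ω → ℝ := fun ω => Real.log (1 + η * X ω) - (Real.log η + Real.log (X ω))
  have hd_le : ∀ᵐ ω ∂P, ‖d ω‖ ≤ η ^ (-s) * (X ω ^ (-s) / s) := by
    filter_upwards [hX_pos] with ω hω using abs_log_one_add_mul_sub_le hη hω hs hs_le
  have hbound : Integrable (fun ω => η ^ (-s) * (X ω ^ (-s) / s)) P :=
    (hX_rpow.div_const s).const_mul _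
  have hlog : Integrable (fun ω => Real.log η + Real.log (X ω)) P :=
    (integrable_const _).add hX_log
  have hd : Integrable d P := by
    refine hbound.mono' (AEStronglyMeasurable.sub ?_ hlog.aestronglyMeasurable) hd_le
    exact ((hX.const_mul η).const_add 1).log.aestronglyMeasurable
  have hmean : ∫ ω, (Real.log η + Real.log (X ω)) ∂P = Real.log η + ∫ ω, Real.log (X ω) ∂P := by
    rw [integral_add (integrable_const _) hX_log, integral_const, probReal_univ, one_smul]
  have hlog_one_add : ∫ ω, Real.log (1 + η * X ω) ∂P =
      ∫ ω, d ω ∂P + (Real.log η + ∫ ω, Real.log (X ω) ∂P) := by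
    rw [← hmean, ← integral_add hd hlog]
    simp only [d, sub_add_cancel]
  rw [hlog_one_add, add_sub_cancel_right, Real.norm_of_nonneg (by positivity : 0 ≤ η ^ (-s)),
    mul_comm, ← integral_const_mul]
  exact norm_integral_le_of_norm_le hbound hd_le

end HighSNR

section AlgebraOfLimits

variable {ι : Type*} {l : Filter ι} {L a b m : ι → ℝ} {A B : ℝ}

lemma tendsto_sq_sub_sq_of_tendsto_mul_sub (hm : Tendsto (fun η => m η - L η) l (𝓝 0))
    (hLm : Tendsto (fun η => L η * (m η - L η)) l (𝓝 0)) :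
    Tendsto (fun η => m η ^ 2 - L η ^ 2) l (𝓝 0) := by
  have hsum := (hm.pow 2).add (hLm.const_mul 2)
  simp only [ne_eq, OfNat.ofNat_ne_zero, not_false_eq_true, zero_pow, mul_zero, add_zero] at hsum
  refine hsum.congr fun η => ?_
  ring

lemma tendsto_div_sq_of_tendsto_sub_add_sq (hL : Tendsto L l atTop)
    (ha : Tendsto (fun η => a η - (A + L η ^ 2)) l (𝓝 0)) :
    Tendsto (fun η => a η / L η ^ 2) l (𝓝 1) := by
  have hL_inv : Tendsto (fun η => (L η ^ 2)⁻¹) l (𝓝 0) :=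
    ((tendsto_pow_atTop two_ne_zero).comp hL).inv_tendsto_atTop
  have hlim := ((ha.add_const A).mul hL_inv).add_const 1
  rw [mul_zero, zero_add] at hlim
  refine hlim.congr' ?_
  filter_upwards [hL.eventually_ne_atTop 0] with η hη
  field_simp
  ring

lemma tendsto_sq_mul_div_sub_div (hL : Tendsto L l atTop)
    (ha : Tendsto (fun η => a η - (A + L η ^ 2)) l (𝓝 0))
    (hb : Tendsto (fun η => b η - (B + L η ^ 2)) l (𝓝 0)) :
    Tendsto (fun η => L η ^ 2 * (a η / b η - (A + L η ^ 2) / (B + L η ^ 2))) l (𝓝 0) := by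
  have hratio (c : ℝ) : Tendsto (fun η => (c + L η ^ 2) / L η ^ 2) l (𝓝 1) :=
    tendsto_div_sq_of_tendsto_sub_add_sq (A := c) hL (by simp [tendsto_const_nhds])
  have hb_ratio := tendsto_div_sq_of_tendsto_sub_add_sq hL hb
  have hlim := (hb_ratio.inv₀ one_ne_zero).mul
    (ha.sub (hb.mul ((hratio A).div (hratio B) one_ne_zero)))
  rw [zero_mul, sub_zero, mul_zero] at hlim
  refine hlim.congr' ?_
  filter_upwards [hL.eventually_ne_atTop 0, hb_ratio.eventually_ne one_ne_zero,
    (hratio B).eventually_ne one_ne_zero] with η hL_ne hb_div hB_div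
  have hb_ne : b η ≠ 0 := by
    rintro hb_zero
    simp [hb_zero] at hb_div
  have hB_ne : B + L η ^ 2 ≠ 0 := by
    rintro hB_zero
    simp [hB_zero] at hB_div
  simp only [Pi.div_apply]
  field_simp
  ring

end AlgebraOfLimits

section MutualInformation

open Asymptotics

lemma logb_two_exp_one : Real.logb 2 (Real.exp 1) = (Real.log 2)⁻¹ := by
  rw [Real.logb, Real.log_exp, one_div]

lemma logb_two_exp_one_ne_zero : Real.logb 2 (Real.exp 1) ≠ 0 := by
  rw [logb_two_exp_one]
  exact inv_ne_zero (Real.log_pos one_lt_two).ne'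

lemma imi_eq_mul_log {Ω : Type*} (h : ℝ → Ω → ℂ) (Ts η : ℝ) (l : ℤ) (ω : Ω) :
    imi h Ts η l ω = Real.logb 2 (Real.exp 1) * Real.log (1 + η * ‖h (l * Ts) ω‖ ^ 2) := by
  rw [imi, logb_two_exp_one, Real.logb, div_eq_inv_mul]

lemma tendsto_log_div_gammaConst :
    Tendsto (fun η : ℝ => Real.log (η / gammaConst)) atTop atTop :=
  Real.tendsto_log_atTop.comp (tendsto_id.atTop_div_const (Real.exp_pos _))

lemma log_div_gammaConst {η : ℝ} (hη : 0 < η) :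
    Real.log (η / gammaConst) = Real.log η - Real.eulerMascheroniConstant := by
  rw [gammaConst, Real.log_div hη.ne' (Real.exp_pos _).ne', Real.log_exp]

lemma isLittleO_log_div_gammaConst {s : ℝ} (hs : 0 < s) :
    (fun η : ℝ => Real.log (η / gammaConst)) =o[atTop] fun η : ℝ => η ^ s := by
  have hconst : (fun _ : ℝ => Real.eulerMascheroniConstant) =o[atTop] fun η : ℝ => η ^ s :=
    isLittleO_const_left.2 <| .inr <| tendsto_norm_atTop_atTop.comp (tendsto_rpow_atTop hs)
  refine ((isLittleO_log_rpow_atTop hs).sub hconst).congr' ?_ .rfl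
  filter_upwards [eventually_gt_atTop 0] with η hη using (log_div_gammaConst hη).symm

namespace IsRayleighFading

variable {Ω : Type*} [MeasurableSpace Ω] {P : Measure Ω} {h : ℝ → Ω → ℂ} {ρh : ℝ → ℂ}

lemma hasLaw_norm_sq (hh : IsRayleighFading P h ρh) (t : ℝ) :
    HasLaw (fun ω => ‖h t ω‖ ^ 2) (expMeasure 1) P :=
  hasLaw_norm_sq_circularGaussian_one (hh.hasLaw t)

lemma ae_norm_sq_pos (hh : IsRayleighFading P h ρh) (t : ℝ) : ∀ᵐ ω ∂P, 0 < ‖h t ω‖ ^ 2 :=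
  ((hh.hasLaw_norm_sq t).ae_iff (by fun_prop)).2 ae_pos_expMeasure

lemma integrable_norm_sq_rpow (hh : IsRayleighFading P h ρh) (t : ℝ) {s : ℝ} (hs : -1 < s) :
    Integrable (fun ω => (‖h t ω‖ ^ 2) ^ s) P :=
  Integrable.comp_aemeasurable (g := fun x : ℝ => x ^ s)
    ((hh.hasLaw_norm_sq t).map_eq ▸ integrable_rpow_expMeasure one_pos hs)
    (hh.hasLaw_norm_sq t).aemeasurable

lemma memLp_two_norm_sq (hh : IsRayleighFading P h ρh) (t : ℝ) :
    MemLp (fun ω => ‖h t ω‖ ^ 2) 2 P := by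
  have hrpow := memLp_two_rpow_expMeasure one_pos (by norm_num : -(1 / 2) < (1 : ℝ))
  simp only [Real.rpow_one] at hrpow
  exact MemLp.comp_of_map (g := fun x : ℝ => x) ((hh.hasLaw_norm_sq t).map_eq ▸ hrpow)
    (hh.hasLaw_norm_sq t).aemeasurable

lemma memLp_two_log_norm_sq (hh : IsRayleighFading P h ρh) (t : ℝ) :
    MemLp (fun ω => Real.log (‖h t ω‖ ^ 2)) 2 P :=
  memLp_two_log_of_hasLaw_expMeasure one_pos (hh.hasLaw_norm_sq t)

lemma integral_log_norm_sq (hh : IsRayleighFading P h ρh) (t : ℝ) :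
    ∫ ω, Real.log (‖h t ω‖ ^ 2) ∂P = -Real.eulerMascheroniConstant := by
  simpa using integral_log_of_hasLaw_expMeasure one_pos (hh.hasLaw_norm_sq t)

lemma aemeasurable_imi (hh : IsRayleighFading P h ρh) (Ts η : ℝ) (l : ℤ) :
    AEMeasurable (imi h Ts η l) P :=
  (((hh.hasLaw_norm_sq _).aemeasurable.const_mul η).const_add 1).log.div_const _

lemma memLp_two_imi (hh : IsRayleighFading P h ρh) (Ts : ℝ) {η : ℝ} (hη : 0 ≤ η) (l : ℤ) :
    MemLp (imi h Ts η l) 2 P := by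
  refine ((hh.memLp_two_norm_sq (l * Ts)).const_mul (Real.logb 2 (Real.exp 1) * η)).mono
    (hh.aemeasurable_imi Ts η l).aestronglyMeasurable (ae_of_all _ fun ω => ?_)
  rw [imi_eq_mul_log, norm_mul, norm_mul, norm_mul, mul_assoc]
  refine mul_le_mul_of_nonneg_left ?_ (norm_nonneg _)
  have hηx : 0 ≤ η * ‖h (l * Ts) ω‖ ^ 2 := by positivity
  rw [← norm_mul, Real.norm_of_nonneg hηx, Real.norm_of_nonneg (Real.log_nonneg (by linarith))]
  linarith [Real.log_le_sub_one_of_pos (by linarith : 0 < 1 + η * ‖h (l * Ts) ω‖ ^ 2)]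

lemma integral_imi_congr (hh : IsRayleighFading P h ρh) (Ts η : ℝ) (l k : ℤ) :
    ∫ ω, imi h Ts η l ω ∂P = ∫ ω, imi h Ts η k ω ∂P := by
  have hlaw (j : ℤ) : ∫ ω, imi h Ts η j ω ∂P = ∫ x, Real.logb 2 (1 + η * x) ∂expMeasure 1 :=
    (hh.hasLaw_norm_sq (j * Ts)).integral_comp (f := fun x => Real.logb 2 (1 + η * x))
      (((measurable_id.const_mul η).const_add 1).log.div_const _).aestronglyMeasurable
  rw [hlaw, hlaw]

lemma imiACF_eq_covariance_add (hh : IsRayleighFading P h ρh) (Ts : ℝ) {η : ℝ} (hη : 0 ≤ η)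
    (l i : ℤ) : imiACF P h Ts η l i =
      cov[imi h Ts η l, imi h Ts η (l - i); P] + (∫ ω, imi h Ts η l ω ∂P) ^ 2 := by
  have := hh.gaussian.isProbabilityMeasure
  rw [covariance_eq_sub (hh.memLp_two_imi Ts hη l) (hh.memLp_two_imi Ts hη (l - i)),
    hh.integral_imi_congr Ts η (l - i) l, imiACF, pow_two, sub_add_cancel]
  rfl

lemma integral_imi_sq (h : ℝ → Ω → ℂ) (Ts η : ℝ) (l : ℤ) :
    ∫ ω, imi h Ts η l ω ^ 2 ∂P = imiACF P h Ts η l 0 := by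
  simp only [imiACF, sub_zero, pow_two]

theorem variance_imi_pos (hh : IsRayleighFading P h ρh) (Ts : ℝ) {η : ℝ} (hη : 0 < η) (l : ℤ) :
    0 < Var[imi h Ts η l; P] := by
  have := hh.gaussian.isProbabilityMeasure
  refine (variance_nonneg _ _).lt_of_ne fun hvar => ?_
  have hconst := ae_eq_integral_of_variance_eq_zero (hh.memLp_two_imi Ts hη.le l) hvar.symm
  set m := ∫ ω, imi h Ts η l ω ∂P
  have hpoint : ∀ᵐ ω ∂P, ‖h (l * Ts) ω‖ ^ 2 = ((2 : ℝ) ^ m - 1) / η := by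
    filter_upwards [hconst] with ω hω
    rw [← hω, imi, Real.rpow_logb two_pos (by norm_num) (by positivity), add_sub_cancel_left,
      mul_div_cancel_left₀ _ hη.ne']
  have := isProbabilityMeasure_expMeasure one_pos
  have hlaw : ∀ᵐ x ∂expMeasure 1, x = ((2 : ℝ) ^ m - 1) / η :=
    ((hh.hasLaw_norm_sq (l * Ts)).ae_iff (by fun_prop)).1 hpoint
  obtain ⟨x, hx, hx_ne⟩ :=
    (hlaw.and (measure_eq_zero_iff_ae_notMem.1 (expMeasure_singleton _))).exists
  exact hx_ne hx

theorem tendsto_covariance_imi_div (hh : IsRayleighFading P h ρh) (Ts : ℝ) (l i : ℤ) :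
    Tendsto (fun η : ℝ => cov[imi h Ts η l, imi h Ts η (l - i); P] /
      Real.logb 2 (Real.exp 1) ^ 2) atTop (𝓝 (dilog (‖ρh (i * Ts)‖ ^ 2))) := by
  have := hh.gaussian.isProbabilityMeasure
  have hlag : ((l - i : ℤ) : ℝ) * Ts = l * Ts - i * Ts := by
    push_cast
    ring
  rw [← hh.covariance_log_norm_sq (l * Ts) (i * Ts), ← hlag]
  refine (tendsto_covariance_log_one_add_mul (hh.memLp_two_norm_sq _) (hh.memLp_two_norm_sq _)
    (hh.ae_norm_sq_pos _) (hh.ae_norm_sq_pos _) (hh.memLp_two_log_norm_sq _)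
    (hh.memLp_two_log_norm_sq _)).congr fun η => ?_
  have himi (k : ℤ) := funext (imi_eq_mul_log h Ts η k)
  rw [himi, himi, covariance_const_mul_left, covariance_const_mul_right, ← mul_assoc, ← pow_two,
    mul_div_cancel_left₀ _ (pow_ne_zero 2 logb_two_exp_one_ne_zero)]

lemma isBigO_integral_imi_div_sub (hh : IsRayleighFading P h ρh) (Ts : ℝ) (l : ℤ) {s : ℝ}
    (hs : 0 < s) (hs_lt : s < 1) :
    (fun η : ℝ => (∫ ω, imi h Ts η l ω ∂P) / Real.logb 2 (Real.exp 1) -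
      Real.log (η / gammaConst)) =O[atTop] fun η : ℝ => η ^ (-s) := by
  have := hh.gaussian.isProbabilityMeasure
  have hO := isBigO_integral_log_one_add_mul_sub (hh.hasLaw_norm_sq (l * Ts)).aemeasurable
    (hh.ae_norm_sq_pos _) ((hh.memLp_two_log_norm_sq _).integrable one_le_two) hs hs_lt.le
    (hh.integrable_norm_sq_rpow _ (neg_lt_neg hs_lt))
  refine hO.congr' ?_ .rfl
  filter_upwards [eventually_gt_atTop 0] with η hη
  simp only [imi_eq_mul_log]
  rw [integral_const_mul, mul_div_cancel_left₀ _ logb_two_exp_one_ne_zero,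
    hh.integral_log_norm_sq, log_div_gammaConst hη, ← sub_eq_add_neg]

lemma tendsto_integral_imi_div_sq_sub (hh : IsRayleighFading P h ρh) (Ts : ℝ) (l : ℤ) :
    Tendsto (fun η : ℝ => ((∫ ω, imi h Ts η l ω ∂P) / Real.logb 2 (Real.exp 1)) ^ 2 -
      Real.log (η / gammaConst) ^ 2) atTop (𝓝 0) := by
  have hs : (0 : ℝ) < 1 / 2 := by norm_num
  have hO := hh.isBigO_integral_imi_div_sub Ts l hs (by norm_num)
  refine tendsto_sq_sub_sq_of_tendsto_mul_sub
    (hO.trans_tendsto (tendsto_rpow_neg_atTop hs)) ?_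
  have hlittle := (isLittleO_log_div_gammaConst hs).mul_isBigO hO
  refine (isLittleO_one_iff ℝ).1 (hlittle.congr' .rfl ?_)
  filter_upwards [eventually_gt_atTop 0] with η hη
  rw [← Real.rpow_add hη, add_neg_cancel, Real.rpow_zero]

theorem tendsto_imiACF_div_sub (hh : IsRayleighFading P h ρh) (Ts : ℝ) (l i : ℤ) :
    Tendsto (fun η : ℝ => imiACF P h Ts η l i / Real.logb 2 (Real.exp 1) ^ 2 -
      (dilog (‖ρh (i * Ts)‖ ^ 2) + Real.log (η / gammaConst) ^ 2)) atTop (𝓝 0) := by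
  have hlim := ((hh.tendsto_covariance_imi_div Ts l i).sub_const (dilog (‖ρh (i * Ts)‖ ^ 2))).add
    (hh.tendsto_integral_imi_div_sq_sub Ts l)
  rw [sub_self, zero_add] at hlim
  refine hlim.congr' ?_
  filter_upwards [eventually_ge_atTop 0] with η hη
  rw [hh.imiACF_eq_covariance_add Ts hη]
  ring

theorem tendsto_integral_imi_sq_div_sub (hh : IsRayleighFading P h ρh) (Ts : ℝ) (l : ℤ) :
    Tendsto (fun η : ℝ => (∫ ω, imi h Ts η l ω ^ 2 ∂P) / Real.logb 2 (Real.exp 1) ^ 2 -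
      (Real.pi ^ 2 / 6 + Real.log (η / gammaConst) ^ 2)) atTop (𝓝 0) := by
  simpa [integral_imi_sq, hh.correlation_zero, dilog_one] using hh.tendsto_imiACF_div_sub Ts l 0

theorem tendsto_imiCorrCoeff (hh : IsRayleighFading P h ρh) (Ts : ℝ) (l i : ℤ) :
    Tendsto (fun η : ℝ => imiCorrCoeff P h Ts η l i) atTop
      (𝓝 (6 * dilog (‖ρh (i * Ts)‖ ^ 2) / Real.pi ^ 2)) := by
  have hvar := hh.tendsto_covariance_imi_div Ts l 0
  simp only [Int.cast_zero, zero_mul, hh.correlation_zero, norm_one, one_pow, dilog_one] at hvar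
  have hlim := (hh.tendsto_covariance_imi_div Ts l i).div hvar (by positivity)
  rw [div_div_eq_mul_div, mul_comm (dilog _)] at hlim
  refine hlim.congr' ?_
  filter_upwards [eventually_ge_atTop 0] with η hη
  rw [imiCorrCoeff, integral_imi_sq, hh.imiACF_eq_covariance_add Ts hη,
    hh.imiACF_eq_covariance_add Ts hη, add_sub_cancel_right, add_sub_cancel_right, Pi.div_apply,
    div_div_div_cancel_right₀ (pow_ne_zero 2 logb_two_exp_one_ne_zero)]

theorem tendsto_imiNACF_sub (hh : IsRayleighFading P h ρh) (Ts : ℝ) (l i : ℤ) :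
    Tendsto (fun η : ℝ => Real.log (η / gammaConst) ^ 2 * (imiNACF P h Ts η l i -
      (dilog (‖ρh (i * Ts)‖ ^ 2) + Real.log (η / gammaConst) ^ 2) /
        (Real.pi ^ 2 / 6 + Real.log (η / gammaConst) ^ 2))) atTop (𝓝 0) := by
  refine (tendsto_sq_mul_div_sub_div tendsto_log_div_gammaConst (hh.tendsto_imiACF_div_sub Ts l i)
    (hh.tendsto_integral_imi_sq_div_sub Ts l)).congr fun η => ?_
  rw [imiNACF, div_div_div_cancel_right₀ (pow_ne_zero 2 logb_two_exp_one_ne_zero)]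

end IsRayleighFading

end MutualInformation

theorem mainTheorem5_general {Ω : Type*} [MeasurableSpace Ω] (P : Measure Ω)
    (h : ℝ → Ω → ℂ) (ρh : ℝ → ℂ) (hh : IsRayleighFading P h ρh)
    (Ts : ℝ) (l i : ℤ) (ϱ : ℝ) (hϱ : ϱ = ‖ρh (i * Ts)‖) :
    (∀ η : ℝ, 0 < η →
      MemLp (imi h Ts η l) 2 P ∧ MemLp (imi h Ts η (l - i)) 2 P ∧
      0 < ∫ ω, imi h Ts η l ω ^ 2 ∂P ∧
      0 < (∫ ω, imi h Ts η l ω ^ 2 ∂P) - (∫ ω, imi h Ts η l ω ∂P) ^ 2) ∧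
    Tendsto (fun η : ℝ => imiACF P h Ts η l i / Real.logb 2 (Real.exp 1) ^ 2 -
        (dilog (ϱ ^ 2) + Real.log (η / gammaConst) ^ 2)) atTop (𝓝 0) ∧
    Tendsto (fun η : ℝ => (∫ ω, imi h Ts η l ω ^ 2 ∂P) / Real.logb 2 (Real.exp 1) ^ 2 -
        (Real.pi ^ 2 / 6 + Real.log (η / gammaConst) ^ 2)) atTop (𝓝 0) ∧
    Tendsto (fun η : ℝ => Real.log (η / gammaConst) ^ 2 *
        (imiNACF P h Ts η l i -
          (dilog (ϱ ^ 2) + Real.log (η / gammaConst) ^ 2) /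
            (Real.pi ^ 2 / 6 + Real.log (η / gammaConst) ^ 2))) atTop (𝓝 0) ∧
    Tendsto (fun η : ℝ => imiCorrCoeff P h Ts η l i) atTop
      (𝓝 (6 * dilog (ϱ ^ 2) / Real.pi ^ 2)) ∧
    (∀ t : ℝ, |t| < 1 →
      HasSum (fun k : ℕ => (harmonic k : ℝ) * t ^ k) (-Real.log (1 - t) / (1 - t)) ∧
      HasSum (fun k : ℕ => (harmonic k : ℝ) ^ 2 * t ^ k)
        ((dilog t + Real.log (1 - t) ^ 2) / (1 - t))) := by
  have := hh.gaussian.isProbabilityMeasure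
  subst hϱ
  refine ⟨fun η hη => ?_, hh.tendsto_imiACF_div_sub Ts l i, hh.tendsto_integral_imi_sq_div_sub Ts l,
    hh.tendsto_imiNACF_sub Ts l i, hh.tendsto_imiCorrCoeff Ts l i,
    fun t ht => ⟨hasSum_harmonic_mul_pow ht, hasSum_harmonic_sq_mul_pow ht⟩⟩
  have hmem := hh.memLp_two_imi Ts hη.le
  have hvar : 0 < (∫ ω, imi h Ts η l ω ^ 2 ∂P) - (∫ ω, imi h Ts η l ω ∂P) ^ 2 :=
    (hh.variance_imi_pos Ts hη l).trans_eq (variance_eq_sub (hmem l))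
  exact ⟨hmem l, hmem (l - i), (sq_nonneg _).trans_lt (sub_pos.1 hvar), hvar⟩

theorem mainTheorem5 {Ω : Type*} [MeasurableSpace Ω] (P : Measure Ω) [IsProbabilityMeasure P]
    (h : ℝ → Ω → ℂ) (ρh : ℝ → ℂ) (hh : IsRayleighFading P h ρh)
    (Ts : ℝ) (hTs : 0 < Ts) (l i : ℤ) (ϱ : ℝ) (hϱ : ϱ = ‖ρh (i * Ts)‖) (hϱ_lt : ϱ < 1) :
    -- the moments and quotients below are genuine for every SNR `η > 0`
    (∀ η : ℝ, 0 < η →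
      MemLp (imi h Ts η l) 2 P ∧ MemLp (imi h Ts η (l - i)) 2 P ∧
      0 < ∫ ω, imi h Ts η l ω ^ 2 ∂P ∧
      0 < (∫ ω, imi h Ts η l ω ^ 2 ∂P) - (∫ ω, imi h Ts η l ω ∂P) ^ 2) ∧
    -- the ACF and the second moment, up to `o(1)`
    Tendsto (fun η : ℝ => imiACF P h Ts η l i / Real.logb 2 (Real.exp 1) ^ 2 -
        (dilog (ϱ ^ 2) + Real.log (η / gammaConst) ^ 2)) atTop (𝓝 0) ∧
    Tendsto (fun η : ℝ => (∫ ω, imi h Ts η l ω ^ 2 ∂P) / Real.logb 2 (Real.exp 1) ^ 2 -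
        (Real.pi ^ 2 / 6 + Real.log (η / gammaConst) ^ 2)) atTop (𝓝 0) ∧
    -- the normalized ACF, up to `o(1 / ln² (η / γ))`
    Tendsto (fun η : ℝ => Real.log (η / gammaConst) ^ 2 *
        (imiNACF P h Ts η l i -
          (dilog (ϱ ^ 2) + Real.log (η / gammaConst) ^ 2) /
            (Real.pi ^ 2 / 6 + Real.log (η / gammaConst) ^ 2))) atTop (𝓝 0) ∧
    -- the correlation coefficient
    Tendsto (fun η : ℝ => imiCorrCoeff P h Ts η l i) atTop
      (𝓝 (6 * dilog (ϱ ^ 2) / Real.pi ^ 2)) ∧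
    -- the generating functions of `H_k` and `H_k²`
    (∀ t : ℝ, |t| < 1 →
      HasSum (fun k : ℕ => (harmonic k : ℝ) * t ^ k) (-Real.log (1 - t) / (1 - t)) ∧
      HasSum (fun k : ℕ => (harmonic k : ℝ) ^ 2 * t ^ k)
        ((dilog t + Real.log (1 - t) ^ 2) / (1 - t))) :=
  mainTheorem5_general P h ρh hh Ts l i ϱ hϱ
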